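/- Let $A$ be a finite nonempty alphabet and $\mathbb{D}$ a countably infinite set of data values. Regular expressions with binding (REWBs) over $A$ are given by $r ::= \varepsilon \mid a \mid a[c] \mid r+r \mid r\cdot r \mid r^* \mid a{\downarrow_x}(r)$, where $a\in A$, $x$ is a variable and $c$ is a Boolean combination of tests $x^{=}$ and $x^{\neq}$. For a partial valuation $\nu$ of the variables by data values that is defined on the free variables of $r$, the language $L(r,\nu)\subseteq (A\times\mathbb{D})^*$ is defined as usual for $\varepsilon,+,\cdot,{}^*$, together with $L(a,\nu)=\{\binom{a}{d} : d\in\mathbb{D}\}$, $L(a[c],\nu)=\{\binom{a}{d} : d,\nu\models c\}$ and $L(a{\downarrow_x}(r),\nu)=\bigcup_{d\in\mathbb{D}}\binom{a}{d}\cdot L(r,\nu[x\to d])$; here $d,\nu\models x^{=}$ iff $\nu(x)=d$, $d,\nu\models x^{\neq}$ iff $\nu(x)\neq d$. The class $F_0$ consists of the REWBs without binding, and $E_1$ is generated by $E_1 ::= F_0 \mid E_1+E_1 \mid E_1\cdot E_1 \mid a{\downarrow_x}(E_1)$ (so no binding occurs inside a star). A data graph consists of a finite set $V$ of vertices and a set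 $E\subseteq V\times A\times\mathbb{D}\times V$ of edges (finite, when it is part of an input). The query evaluation problem for $E_1$ is: given a data graph $G$, an expression $e\in E_1$, a valuation $\nu$ of the free variables of $e$, and a pair $(u,v)$ of vertices of $G$, decide whether there is a path from $u$ to $v$ in $G$ whose sequence of edge labels is a word of $L(e,\nu)$. (In instances, vertices, variables and data values are named by binary words, and an instance is written as a word over a finite alphabet in the obvious way.) **Theorem.** For every finite nonempty alphabet $A$, the query evaluation problem for $E_1$ is NP-hard: for every language $L\subseteq\{0,1\}^*$ in NP there is a polynomial-time computable function $f$ from $\{0,1\}^*$ to instances of the query evaluation problem for $E_1$ such that $w\in L$ if and only if $f(w)$ is a yes-instance. -/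

import Mathlib

namespace RegBind

/-! ## Regular expressions with binding

`A` is the alphabet, `X` the set of variables, `D` the set of data values. -/

/-- Boolean combinations of the tests `x⁼` and `x^≠`. -/
inductive Cond (X : Type) : Type where
  | eq (x : X) : Cond X
  | ne (x : X) : Cond X
  | not (c : Cond X) : Cond X
  | and (c c' : Cond X) : Cond X
  | or (c c' : Cond X) : Cond X

/-- The variables occurring in a condition. -/
def Cond.vars {X : Type} : Cond X → Set X
  | .eq x => {x}
  | .ne x => {x}
  | .not c => c.vars
  | .and c c' => c.vars ∪ c'.vars
  | .or c c' => c.vars ∪ c'.vars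

/-- `c.Sat d ν`: the data value `d` and the partial valuation `ν` satisfy `c`. -/
def Cond.Sat {X D : Type} (d : D) (ν : X → Option D) : Cond X → Prop
  | .eq x => ν x = some d
  | .ne x => ν x ≠ some d
  | .not c => ¬ c.Sat d ν
  | .and c c' => c.Sat d ν ∧ c'.Sat d ν
  | .or c c' => c.Sat d ν ∨ c'.Sat d ν

/-- Regular expressions with binding: `ε`, `a`, `a[c]`, `r + s`, `r · s`, `r*`, `a↓x(r)`. -/
inductive REWB (A X : Type) : Type where
  | eps : REWB A X
  | sym (a : A) : REWB A X
  | test (a : A) (c : Cond X) : REWB A X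
  | plus (r s : REWB A X) : REWB A X
  | cat (r s : REWB A X) : REWB A X
  | star (r : REWB A X) : REWB A X
  | bind (a : A) (x : X) (r : REWB A X) : REWB A X

namespace REWB

/-- The free variables. -/
def fv {A X : Type} : REWB A X → Set X
  | eps => ∅
  | sym _ => ∅
  | test _ c => c.vars
  | plus r s => r.fv ∪ s.fv
  | cat r s => r.fv ∪ s.fv
  | star r => r.fv
  | bind _ x r => r.fv \ {x}

/-- The language `L(r, ν)` of data words. -/
def lang {A X D : Type} [DecidableEq X] : REWB A X → (X → Option D) → Language (A × D)
  | eps, _ => 1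
  | sym a, _ => {w | ∃ d : D, w = [(a, d)]}
  | test a c, ν => {w | ∃ d : D, c.Sat d ν ∧ w = [(a, d)]}
  | plus r s, ν => r.lang ν + s.lang ν
  | cat r s, ν => r.lang ν * s.lang ν
  | star r, ν => KStar.kstar (r.lang ν)
  | bind a x r, ν =>
      {w | ∃ (d : D) (w' : List (A × D)),
        w' ∈ r.lang (Function.update ν x (some d)) ∧ w = (a, d) :: w'}

mutual
/-- `LevelE i r`: the expression `r` is generated by `E_i` (for `i ≥ 1`; there is no `E_0`). -/
inductive LevelE {A X : Type} : ℕ → REWB A X → Prop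
  | ofF {i : ℕ} {r : REWB A X} : LevelF i r → LevelE (i + 1) r
  | plus {i : ℕ} {r s : REWB A X} :
      LevelE (i + 1) r → LevelE (i + 1) s → LevelE (i + 1) (.plus r s)
  | cat {i : ℕ} {r s : REWB A X} :
      LevelE (i + 1) r → LevelE (i + 1) s → LevelE (i + 1) (.cat r s)
  | bind {i : ℕ} {a : A} {x : X} {r : REWB A X} :
      LevelE (i + 1) r → LevelE (i + 1) (.bind a x r)
/-- `LevelF i r`: the expression `r` is generated by `F_i`. -/
inductive LevelF {A X : Type} : ℕ → REWB A X → Prop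
  | eps : LevelF 0 .eps
  | sym {a : A} : LevelF 0 (.sym a)
  | test {a : A} {c : Cond X} : LevelF 0 (.test a c)
  | ofE {i : ℕ} {r : REWB A X} : LevelE (i + 1) r → LevelF (i + 1) r
  | plus {i : ℕ} {r s : REWB A X} : LevelF i r → LevelF i s → LevelF i (.plus r s)
  | cat {i : ℕ} {r s : REWB A X} : LevelF i r → LevelF i s → LevelF i (.cat r s)
  | star {i : ℕ} {r : REWB A X} : LevelF i r → LevelF i (.star r)
end

end REWB

/-! ## Data graphs -/

/-- A data graph: a finite set `V` of vertices (taken from a supply `N` of possible vertices) and a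
set `E ⊆ V × A × D × V` of labelled edges. -/
structure DataGraph (N A D : Type) where
  V : Set N
  E : Set (N × A × D × N)
  finite_V : V.Finite
  src_mem : ∀ u a d v, (u, a, d, v) ∈ E → u ∈ V
  tgt_mem : ∀ u a d v, (u, a, d, v) ∈ E → v ∈ V

/-- `G.Path u w v`: there is a data path from `u` to `v` whose edge labels form the word `w`. -/
inductive DataGraph.Path {N A D : Type} (G : DataGraph N A D) : N → List (A × D) → N → Prop
  | nil {u : N} : u ∈ G.V → G.Path u [] u
  | cons {u v t : N} {a : A} {d : D} {w : List (A × D)} :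
      (u, a, d, v) ∈ G.E → G.Path v w t → G.Path u ((a, d) :: w) t

/-! ## Instances of the query evaluation problem

To be written down, vertices, variables and data values are named by binary words.  In particular
the countably infinite set of data values is the set of binary words. -/

/-- Names of vertices, variables and data values. -/
abbrev Name : Type := List Bool

/-- The data of an instance: the listed vertices and edges of a data graph, an expression, a finite
partial valuation listed as pairs (variable, value), and a pair of vertices. -/
structure RawInstance (A : Type) where
  vertices : List Name
  edges : List (Name × A × Name × Name)
  expr : REWB A Name
  valuation : List (Name × Name)
  source : Name
  target : Name

/-- Instances of the query evaluation problem for queries in `E_i` over the alphabet `A`: a data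
graph `G`, an expression `e` in `E_i`, a valuation of the free variables of `e`, and a pair of
vertices of `G`. -/
structure EvalInstance (A : Type) (i : ℕ) extends RawInstance A where
  src_mem : ∀ u a d v, (u, a, d, v) ∈ edges → u ∈ vertices
  tgt_mem : ∀ u a d v, (u, a, d, v) ∈ edges → v ∈ vertices
  level : REWB.LevelE i expr
  nodup : (valuation.map Prod.fst).Nodup
  dom : ∀ x, x ∈ valuation.map Prod.fst ↔ x ∈ expr.fv
  source_mem : source ∈ vertices
  target_mem : target ∈ vertices

/-- The data graph of an instance. -/
def EvalInstance.graph {A : Type} {i : ℕ} (I : EvalInstance A i) : DataGraph Name A Name where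
  V := {v | v ∈ I.vertices}
  E := {e | e ∈ I.edges}
  finite_V := List.finite_toSet I.vertices
  src_mem := I.src_mem
  tgt_mem := I.tgt_mem

/-- The valuation of an instance, as a partial function. -/
def EvalInstance.val {A : Type} {i : ℕ} (I : EvalInstance A i) (x : Name) : Option Name :=
  I.valuation.lookup x

/-- The query evaluation problem for `E_i`, as the set of its yes-instances: the source is connected
to the target by a data path whose data word is in `L(e, ν)`. -/
def queryEvaluation (A : Type) (i : ℕ) : Set (EvalInstance A i) :=
  {I | ∃ w : List (A × Name), I.graph.Path I.source w I.target ∧ w ∈ I.expr.lang I.val}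

/-! ## Writing instances as words

Names are written out literally and closed by a marker; expressions and conditions are written in
prefix notation; lists are closed by a marker. -/

/-- Punctuation marks and operators used to write instances. -/
inductive Mark : Type where
  | bit (b : Bool) | close | item
  | eq | ne | not | and | or
  | eps | sym | test | plus | cat | star | bind
  deriving DecidableEq, Fintype

/-- The finite alphabet in which instances over the alphabet `A` are written. -/
abbrev Token (A : Type) : Type := Mark ⊕ A

section Encode

variable {A : Type}

/-- A mark, as a token. -/
abbrev mk (m : Mark) : Token A := Sum.inl m

def encName : Name → List (Token A)
  | [] => [mk .close]
  | b :: w => mk (.bit b) :: encName w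

def encList {β : Type} (f : β → List (Token A)) : List β → List (Token A)
  | [] => [mk .close]
  | b :: l => mk .item :: (f b ++ encList f l)

def encEdge (e : Name × A × Name × Name) : List (Token A) :=
  encName e.1 ++ (Sum.inr e.2.1 :: (encName e.2.2.1 ++ encName e.2.2.2))

def encPair (p : Name × Name) : List (Token A) :=
  encName p.1 ++ encName p.2

def encCond : Cond Name → List (Token A)
  | .eq x => mk .eq :: encName x
  | .ne x => mk .ne :: encName x
  | .not c => mk .not :: encCond c
  | .and c c' => mk .and :: (encCond c ++ encCond c')
  | .or c c' => mk .or :: (encCond c ++ encCond c')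

def encExpr : REWB A Name → List (Token A)
  | .eps => [mk .eps]
  | .sym a => [mk .sym, Sum.inr a]
  | .test a c => mk .test :: Sum.inr a :: encCond c
  | .plus r s => mk .plus :: (encExpr r ++ encExpr s)
  | .cat r s => mk .cat :: (encExpr r ++ encExpr s)
  | .star r => mk .star :: encExpr r
  | .bind a x r => mk .bind :: Sum.inr a :: (encName x ++ encExpr r)

def encRaw (I : RawInstance A) : List (Token A) :=
  encList encName I.vertices ++ (encList encEdge I.edges ++ (encExpr I.expr ++
    (encList encPair I.valuation ++ (encName I.source ++ encName I.target))))

theorem encName_inj : ∀ (x y : Name) (s t : List (Token A)),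
    encName x ++ s = encName y ++ t → x = y ∧ s = t
  | [], [], s, t, h => by simpa [encName] using h
  | [], _ :: _, s, t, h => by simp [encName] at h
  | _ :: _, [], s, t, h => by simp [encName] at h
  | b :: x, c :: y, s, t, h => by
      simp only [encName, List.cons_append, List.cons.injEq, Sum.inl.injEq, Mark.bit.injEq] at h
      obtain ⟨h1, h2⟩ := encName_inj x y s t h.2
      exact ⟨by rw [h.1, h1], h2⟩

theorem encList_inj {β : Type} (f : β → List (Token A))
    (hf : ∀ x y s t, f x ++ s = f y ++ t → x = y ∧ s = t) :
    ∀ (x y : List β) (s t : List (Token A)),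
      encList f x ++ s = encList f y ++ t → x = y ∧ s = t
  | [], [], s, t, h => by simpa [encList] using h
  | [], _ :: _, s, t, h => by simp [encList] at h
  | _ :: _, [], s, t, h => by simp [encList] at h
  | b :: x, c :: y, s, t, h => by
      simp only [encList, List.cons_append, List.append_assoc, List.cons.injEq, true_and] at h
      obtain ⟨h0, h'⟩ := hf _ _ _ _ h
      obtain ⟨h1, h2⟩ := encList_inj f hf x y s t h'
      exact ⟨by rw [h0, h1], h2⟩

theorem encEdge_inj (x y : Name × A × Name × Name) (s t : List (Token A))
    (h : encEdge x ++ s = encEdge y ++ t) : x = y ∧ s = t := by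
  obtain ⟨x1, x2, x3, x4⟩ := x
  obtain ⟨y1, y2, y3, y4⟩ := y
  simp only [encEdge, List.append_assoc, List.cons_append] at h
  obtain ⟨rfl, k1⟩ := encName_inj _ _ _ _ h
  simp only [List.cons.injEq, Sum.inr.injEq] at k1
  obtain ⟨rfl, k2⟩ := k1
  obtain ⟨rfl, k3⟩ := encName_inj _ _ _ _ k2
  obtain ⟨rfl, k4⟩ := encName_inj _ _ _ _ k3
  exact ⟨rfl, k4⟩

theorem encPair_inj (x y : Name × Name) (s t : List (Token A))
    (h : encPair x ++ s = encPair y ++ t) : x = y ∧ s = t := by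
  obtain ⟨x1, x2⟩ := x
  obtain ⟨y1, y2⟩ := y
  simp only [encPair, List.append_assoc] at h
  obtain ⟨rfl, k5⟩ := encName_inj _ _ _ _ h
  obtain ⟨rfl, k6⟩ := encName_inj _ _ _ _ k5
  exact ⟨rfl, k6⟩

theorem encCond_inj (x : Cond Name) : ∀ (y : Cond Name) (s t : List (Token A)),
    encCond x ++ s = encCond y ++ t → x = y ∧ s = t := by
  induction x with
  | eq x | ne x =>
    intro y s t h
    cases y <;> simp [encCond] at h
    obtain ⟨rfl, k7⟩ := encName_inj _ _ _ _ h
    exact ⟨rfl, k7⟩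
  | not c ih =>
    intro y s t h
    cases y <;> simp [encCond] at h
    obtain ⟨rfl, k8⟩ := ih _ _ _ h
    exact ⟨rfl, k8⟩
  | and c c' ih ih' | or c c' ih ih' =>
    intro y s t h
    cases y <;> simp [encCond] at h
    obtain ⟨rfl, k9⟩ := ih _ _ _ h
    obtain ⟨rfl, k10⟩ := ih' _ _ _ k9
    exact ⟨rfl, k10⟩

theorem encExpr_inj (x : REWB A Name) : ∀ (y : REWB A Name) (s t : List (Token A)),
    encExpr x ++ s = encExpr y ++ t → x = y ∧ s = t := by
  induction x with
  | eps =>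
    intro y s t h
    cases y <;> simp [encExpr] at h
    exact ⟨rfl, h⟩
  | sym a =>
    intro y s t h
    cases y <;> simp [encExpr] at h
    exact ⟨by rw [h.1], h.2⟩
  | test a c =>
    intro y s t h
    cases y <;> simp [encExpr] at h
    obtain ⟨rfl, k11⟩ := h
    obtain ⟨rfl, k12⟩ := encCond_inj _ _ _ _ k11
    exact ⟨rfl, k12⟩
  | star r ih =>
    intro y s t h
    cases y <;> simp [encExpr] at h
    obtain ⟨rfl, k13⟩ := ih _ _ _ h
    exact ⟨rfl, k13⟩
  | plus r s ih ih' | cat r s ih ih' =>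
    intro y s t h
    cases y <;> simp [encExpr] at h
    obtain ⟨rfl, k14⟩ := ih _ _ _ h
    obtain ⟨rfl, k15⟩ := ih' _ _ _ k14
    exact ⟨rfl, k15⟩
  | bind a x r ih =>
    intro y s t h
    cases y <;> simp [encExpr] at h
    obtain ⟨rfl, k16⟩ := h
    obtain ⟨rfl, k17⟩ := encName_inj _ _ _ _ k16
    obtain ⟨rfl, k18⟩ := ih _ _ _ k17
    exact ⟨rfl, k18⟩

theorem encRaw_injective : Function.Injective (encRaw : RawInstance A → List (Token A)) := by
  rintro ⟨x1, x2, x3, x4, x5, x6⟩ ⟨y1, y2, y3, y4, y5, y6⟩ h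
  simp only [encRaw] at h
  obtain ⟨rfl, k19⟩ := encList_inj _ encName_inj _ _ _ _ h
  obtain ⟨rfl, k20⟩ := encList_inj _ encEdge_inj _ _ _ _ k19
  obtain ⟨rfl, k21⟩ := encExpr_inj _ _ _ _ k20
  obtain ⟨rfl, k22⟩ := encList_inj _ encPair_inj _ _ _ _ k21
  obtain ⟨rfl, k23⟩ := encName_inj _ _ _ _ k22
  have h' : encName x6 ++ ([] : List (Token A)) = encName y6 ++ [] := by simpa using k23
  obtain ⟨rfl, -⟩ := encName_inj _ _ _ _ h'
  rfl

theorem encInstance_injective {i : ℕ} :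
    Function.Injective fun I : EvalInstance A i => encRaw I.toRawInstance := by
  intro I J h
  have h' := encRaw_injective h
  cases I
  cases J
  simp only at h'
  subst h'
  rfl

open Classical in
/-- The encoding of instances as words over the finite alphabet `Token A`. -/
noncomputable def instanceEncoding (A : Type) (i : ℕ) :
    Computability.Encoding (EvalInstance A i) (Token A) where
  encode I := encRaw I.toRawInstance
  decode w := if h : ∃ I : EvalInstance A i, encRaw I.toRawInstance = w then some h.choose else none
  decode_encode I := by
    have h : ∃ J : EvalInstance A i, encRaw J.toRawInstance = encRaw I.toRawInstance := ⟨I, rfl⟩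
    rw [dif_pos h]
    exact congrArg some (encInstance_injective h.choose_spec)

end Encode

/-! ## The class NP and NP-hardness -/

/-- Nondeterministic one-tape Turing machines with input alphabet `α`.  The blank is the default
element of the tape alphabet, and is not an input letter. -/
structure NTM (α : Type) where
  Q : Type
  Γ : Type
  [finite_Q : Finite Q]
  [finite_Γ : Finite Γ]
  [blank : Inhabited Γ]
  letter : α → Γ
  letter_injective : Function.Injective letter
  letter_ne_blank : ∀ a, letter a ≠ default
  start : Q
  accept : Set Q
  δ : Q → Γ → Set (Q × Γ × Turing.Dir)

namespace NTM

variable {α : Type} (M : NTM α)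

instance : Inhabited M.Γ := M.blank

/-- A configuration: a state, and a two-way infinite tape with a head. -/
structure Cfg where
  state : M.Q
  tape : Turing.Tape M.Γ

/-- The start configuration: the head is on the first letter of the input. -/
def startCfg (w : List α) : M.Cfg := ⟨M.start, Turing.Tape.mk₁ (w.map M.letter)⟩

/-- One step: read the scanned symbol, choose a transition, write, move, change state. -/
def Step (c c' : M.Cfg) : Prop :=
  ∃ q b dir, (q, b, dir) ∈ M.δ c.state c.tape.head ∧ c' = ⟨q, (c.tape.write b).move dir⟩

/-- Some computation of exactly `t` steps on input `w` ends in an accepting state. -/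
def AcceptsIn (w : List α) (t : ℕ) : Prop :=
  ∃ c : ℕ → M.Cfg, c 0 = M.startCfg w ∧ (∀ j < t, M.Step (c j) (c (j + 1))) ∧
    (c t).state ∈ M.accept

end NTM

/-- The class NP: languages of nondeterministic Turing machines with polynomially long accepting
computations. -/
def InNP (L : Language Bool) : Prop :=
  ∃ (M : NTM Bool) (p : Polynomial ℕ), ∀ w : List Bool,
    (w ∈ L → ∃ t ≤ p.eval w.length, M.AcceptsIn w t) ∧ ((∃ t, M.AcceptsIn w t) → w ∈ L)

/-- NP-hardness of the decision problem with set of yes-instances `P ⊆ β`, where the instances are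
written as words over the finite alphabet `Γ`: every language in NP has a polynomial-time many-one
reduction to `P`. -/
def NPHard {β Γ : Type} [Fintype Γ] (enc : Computability.Encoding β Γ) (P : Set β) : Prop :=
  ∀ L : Language Bool, InNP L →
    ∃ f : List Bool → β,
      Nonempty (Turing.TM2ComputableInPolyTime (fun w : List Bool => w) enc.encode f) ∧
        ∀ w, w ∈ L ↔ f w ∈ P

end RegBind

-- The reduction is the Cook–Levin tableau, with bindings in the role of existential quantifiers. An
-- expression `a↓x₁(a↓x₂(… a[c] …))` lies in `E_1`, and over a one-vertex graph with an `a`-loop for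
-- each of the data values `[false]` and `[true]` it guesses a value for every `xᵢ` and then tests
-- `c`. For the data value `d` read last, `c` is a Boolean formula in the statements "`xᵢ` holds
-- `d`". Hence the query succeeds iff `c` is satisfiable (`satInstance_mem_iff`).
--
-- It remains to describe an accepting computation by a satisfiable formula of polynomial size. A
-- row of the table is a configuration seen from the head: column `0` carries the state, the action
-- and the scanned symbol, and column `j` the symbols at distance `j` on either side of the head. A
-- move shifts both half-tapes by one cell, so consecutive rows are related by conditions on column
-- `0` and two adjacent columns (`NTM.Window`). The right border is unconstrained, so one more
-- column may become unreliable at each step; with at least as many columns as steps, the head is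
-- never affected (`NTM.IsTable.acceptsIn`). Pauses stretch accepting computations to the prescribed
-- height (`NTM.exists_isTable`).
--
-- A cell with a tile from a finite set `S` is encoded by one Boolean variable per element of `S`.
-- No clause demands exactly one true variable: `pick` decodes every assignment. A window condition
-- is thus a Boolean function of finitely many variables, and every such function is definable
-- (`Cond.definable`). The resulting conditions depend only on the machine, so they are constants of
-- the reduction.
--
-- For polynomial time, a small language of counter programs is compiled to multi-stack machines
-- (`Prog.computable`). The program `tableProg` writes the encoded instance from its end to its
-- beginning, since output is pushed at the front; its running time is bounded by combining the
-- bounds of its parts (`polyRuns_tableProg`).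

namespace RegBind

/-! ## Counter programs and their compilation to multi-stack machines -/

/-- The stacks used by a program: an input, an output, and unary counters. -/
inductive Stack (C : Type) : Type where
  | inp | out | cnt (c : C)
  deriving DecidableEq, Fintype

/-- The alphabets of the stacks. -/
def StackAlph (α β : Type) {C : Type} : Stack C → Type
  | .inp => α
  | .out => β
  | .cnt _ => Unit

/-- Programs that read letters from `α`, write letters from `β` in front of the output, and use
counters from `C`. -/
inductive Prog (α β C : Type) : Type where
  | skip : Prog α β C
  | emit (x : β) : Prog α β C
  | inc (c : C) : Prog α β C
  | seq (p q : Prog α β C) : Prog α β C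
  | loop (c : C) (p : Prog α β C) : Prog α β C
  | read (p : α → Prog α β C) : Prog α β C

/-- The memory of a program. -/
structure Store (α β C : Type) : Type where
  inp : List α
  out : List β
  cnt : C → ℕ

/-- The stacks representing a store. -/
def Store.stk {α β C : Type} (s : Store α β C) : ∀ k : Stack C, List (StackAlph α β k)
  | .inp => s.inp
  | .out => s.out
  | .cnt c => List.replicate (s.cnt c) ()

section Semantics

variable {α β C : Type} [DecidableEq C]

/-- `Exec p s s' n`: started in the store `s`, the program `p` ends after `n` steps in `s'`. -/
inductive Exec : Prog α β C → Store α β C → Store α β C → ℕ → Prop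
  | skip {s} : Exec .skip s s 1
  | emit {x i o f} : Exec (.emit x) ⟨i, o, f⟩ ⟨i, x :: o, f⟩ 1
  | inc {c i o f} : Exec (.inc c) ⟨i, o, f⟩ ⟨i, o, Function.update f c (f c + 1)⟩ 1
  | seq {p q s s₁ s₂ m n} : Exec p s s₁ m → Exec q s₁ s₂ n → Exec (.seq p q) s s₂ (m + n)
  | loop_zero {c p s} : s.cnt c = 0 → Exec (.loop c p) s s 1
  | loop_succ {c p i o f k s₁ s₂ m n} : f c = k + 1 →
      Exec p ⟨i, o, Function.update f c k⟩ s₁ m → Exec (.loop c p) s₁ s₂ n →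
      Exec (.loop c p) ⟨i, o, f⟩ s₂ (1 + (m + n))
  | read_nil {p s} : s.inp = [] → Exec (.read p) s s 1
  | read_cons {p a i o f s₁ s₂ m n} :
      Exec (p a) ⟨i, o, f⟩ s₁ m → Exec (.read p) s₁ s₂ n →
      Exec (.read p) ⟨a :: i, o, f⟩ s₂ (1 + (m + n))

end Semantics

namespace Prog

variable {α β C : Type}

/-- The labels of the compiled program. -/
def Label : Prog α β C → Type
  | skip => Unit
  | emit _ => Unit
  | inc _ => Unit
  | seq p q => p.Label ⊕ q.Label
  | loop _ p => Option p.Label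
  | read p => Option (Σ a, (p a).Label)

/-- The label at which the compiled program starts. -/
def entry : ∀ p : Prog α β C, p.Label
  | skip => ()
  | emit _ => ()
  | inc _ => ()
  | seq p _ => .inl p.entry
  | loop _ _ => none
  | read _ => none

theorem finite_label [Finite α] : ∀ p : Prog α β C, Finite p.Label
  | skip => inferInstanceAs (Finite Unit)
  | emit _ => inferInstanceAs (Finite Unit)
  | inc _ => inferInstanceAs (Finite Unit)
  | seq p q => by
      have := p.finite_label
      have := q.finite_label
      exact inferInstanceAs (Finite (p.Label ⊕ q.Label))
  | loop _ p => by
      have := p.finite_label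
      exact inferInstanceAs (Finite (Option p.Label))
  | read p => by
      have := fun a => (p a).finite_label
      exact inferInstanceAs (Finite (Option (Σ a, (p a).Label)))

open Turing.TM2 in
/-- The statements of the compiled program, in a machine whose labels contain those of the program
by way of `emb`; control is passed to the label `next` at the end. -/
def code {Λ : Type} : ∀ p : Prog α β C, (p.Label → Λ) → Λ → p.Label →
    Stmt (StackAlph α β : Stack C → Type) Λ (Option α × Bool)
  | skip, _, next, _ => .goto fun _ => next
  | emit x, _, next, _ => .push .out (fun _ => x) (.goto fun _ => next)
  | inc c, _, next, _ => .push (.cnt c) (fun _ => ()) (.goto fun _ => next)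
  | seq p q, emb, _, .inl l => p.code (emb ∘ .inl) (emb (.inr q.entry)) l
  | seq _ q, emb, next, .inr l => q.code (emb ∘ .inr) next l
  | loop c p, emb, next, none =>
      .pop (.cnt c) (fun v x => (v.1, Option.isSome x))
        (.goto fun v => bif v.2 then emb (some p.entry) else next)
  | loop _ p, emb, _, some l => p.code (emb ∘ some) (emb none) l
  | read p, emb, next, none =>
      .pop .inp (fun v x => (x, v.2))
        (.goto fun v => v.1.elim next fun a => emb (some ⟨a, (p a).entry⟩))
  | read p, emb, _, some ⟨a, l⟩ => (p a).code (fun l => emb (some ⟨a, l⟩)) (emb none) l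

end Prog

-- Correctness of the compilation

section Compile

variable {α β C : Type} [DecidableEq C]

@[simp]
theorem Store.update_out (i : List α) (o o' : List β) (f : C → ℕ) :
    Function.update (Store.mk i o f).stk .out o' = (Store.mk i o' f).stk := by
  funext k
  cases k <;> rfl

@[simp]
theorem Store.update_inp (i i' : List α) (o : List β) (f : C → ℕ) :
    Function.update (Store.mk i o f).stk .inp i' = (Store.mk i' o f).stk := by
  funext k
  cases k <;> rfl

@[simp]
theorem Store.update_cnt (i : List α) (o : List β) (f : C → ℕ) (c : C) (m : ℕ) :
    Function.update (Store.mk i o f).stk (.cnt c) (List.replicate m ()) =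
      (Store.mk i o (Function.update f c m)).stk := by
  funext k
  cases k with
  | inp => rfl
  | out => rfl
  | cnt d =>
    by_cases h : d = c
    · subst h
      simp [Store.stk]
    · rw [Function.update_of_ne (by simpa using h)]
      simp [Store.stk, Function.update_of_ne h]

/-- `n` steps of a transition function lead from `c` to `c'`. -/
def StepsTo {σ : Type} (f : σ → Option σ) (n : ℕ) (c c' : σ) : Prop :=
  (flip bind f)^[n] (some c) = some c'

theorem StepsTo.one {σ : Type} {f : σ → Option σ} {c c' : σ} (h : f c = some c') :
    StepsTo f 1 c c' := h

theorem StepsTo.trans {σ : Type} {f : σ → Option σ} {m n : ℕ} {c₁ c₂ c₃ : σ}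
    (h : StepsTo f m c₁ c₂) (h' : StepsTo f n c₂ c₃) : StepsTo f (m + n) c₁ c₃ := by
  unfold StepsTo at *
  rw [Nat.add_comm, Function.iterate_add_apply, h, h']

theorem StepsTo.of_label {K Λ σ : Type} {Γ : K → Type} [DecidableEq K]
    {M : Λ → Turing.TM2.Stmt Γ Λ σ} {l : Λ} {q : Turing.TM2.Stmt Γ Λ σ} {v : σ}
    {S : ∀ k, List (Γ k)} {c : Turing.TM2.Cfg Γ Λ σ} (h : M l = q)
    (hq : Turing.TM2.stepAux q v S = c) : StepsTo (Turing.TM2.step M) 1 ⟨some l, v, S⟩ c :=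
  .one (by rw [Turing.TM2.step, h, hq])

/-- Induction on the execution. The ambient machine, the embedding of labels and the exit label are
arbitrary because a subprogram runs inside a larger one and exits into it. The internal memory may
be arbitrary at the start, since a branch only inspects what has just been popped. -/
theorem Exec.stepsTo {p : Prog α β C} {s s' : Store α β C} {n : ℕ} (h : Exec p s s' n) :
    ∀ {Λ : Type} (M : Λ → Turing.TM2.Stmt (StackAlph α β) Λ (Option α × Bool))
      (emb : p.Label → Λ) (next : Λ), (∀ l, M (emb l) = p.code emb next l) → ∀ v, ∃ v',
      StepsTo (Turing.TM2.step M) n ⟨some (emb p.entry), v, s.stk⟩ ⟨some next, v', s'.stk⟩ := by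
  induction h with
  | skip =>
    intro Λ M emb next hM v
    exact ⟨v, .of_label (hM ()) rfl⟩
  | emit =>
    intro Λ M emb next hM v
    exact ⟨v, .of_label (hM ()) (congrArg (Turing.TM2.Cfg.mk _ v) (Store.update_out _ _ _ _))⟩
  | @inc c i o f =>
    intro Λ M emb next hM v
    exact ⟨v, .of_label (hM ())
      (congrArg (Turing.TM2.Cfg.mk _ v) (Store.update_cnt _ _ _ _ (f c + 1)))⟩
  | @seq p q s s₁ s₂ m n _ _ ih ih' =>
    intro Λ M emb next hM v
    obtain ⟨v₁, h₁⟩ := ih M (emb ∘ Sum.inl) (emb (Sum.inr q.entry)) (fun l => hM (Sum.inl l)) v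
    obtain ⟨v₂, h₂⟩ := ih' M (emb ∘ Sum.inr) next (fun l => hM (Sum.inr l)) v₁
    exact ⟨v₂, h₁.trans h₂⟩
  | @loop_zero c p s hs =>
    intro Λ M emb next hM v
    obtain ⟨i, o, f⟩ := s
    refine ⟨(v.1, false), .of_label (hM none) ?_⟩
    have hf : (Store.mk i o f).stk (.cnt c) = List.replicate 0 () := congrArg (List.replicate · ()) hs
    change Turing.TM2.stepAux (.pop (Stack.cnt c) (fun v x => (v.1, Option.isSome x))
      (.goto fun v => bif v.2 then emb (some p.entry) else next)) v _ = _
    rw [Turing.TM2.stepAux, hf]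
    -- Popping an empty stack leaves all stacks as they were.
    refine congrArg (Turing.TM2.Cfg.mk _ _) (Eq.trans ?_ (Function.update_eq_self (Stack.cnt c) _))
    rw [hf]
    rfl
  | @loop_succ c p i o f k s₁ s₂ m n hs _ _ ih ih' =>
    intro Λ M emb next hM v
    obtain ⟨v₁, h₁⟩ := ih M (emb ∘ some) (emb none) (fun l => hM (some l)) (v.1, true)
    obtain ⟨v₂, h₂⟩ := ih' M emb next hM v₁
    refine ⟨v₂, .trans (.of_label (hM none) ?_) (h₁.trans h₂)⟩
    have hf : (Store.mk i o f).stk (.cnt c) = List.replicate (k + 1) () :=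
      congrArg (List.replicate · ()) hs
    change Turing.TM2.stepAux (.pop (Stack.cnt c) (fun v x => (v.1, Option.isSome x))
      (.goto fun v => bif v.2 then emb (some p.entry) else next)) v _ = _
    rw [Turing.TM2.stepAux, hf]
    exact congrArg (Turing.TM2.Cfg.mk _ _) (Store.update_cnt i o f c k)
  | @read_nil p s hs =>
    intro Λ M emb next hM v
    obtain ⟨i, o, f⟩ := s
    simp only at hs
    subst hs
    exact ⟨(none, v.2), .of_label (hM none)
      (congrArg (Turing.TM2.Cfg.mk _ _) (Store.update_inp [] [] o f))⟩
  | @read_cons p a i o f s₁ s₂ m n _ _ ih ih' =>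
    intro Λ M emb next hM v
    obtain ⟨v₁, h₁⟩ := ih M (fun l => emb (some ⟨a, l⟩)) (emb none)
      (fun l => hM (some ⟨a, l⟩)) (some a, v.2)
    obtain ⟨v₂, h₂⟩ := ih' M emb next hM v₁
    exact ⟨v₂, .trans (.of_label (hM none)
      (congrArg (Turing.TM2.Cfg.mk _ _) (Store.update_inp (a :: i) i o f))) (h₁.trans h₂)⟩

variable [Fintype C] [Fintype α]

/-- The machine that runs a program and then halts. -/
noncomputable def Prog.tm (p : Prog α β C) : Turing.FinTM2 where
  K := Stack C
  k₀ := .inp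
  k₁ := .out
  Γ := StackAlph α β
  Λ := Option p.Label
  main := some p.entry
  ΛFin := by
    have := p.finite_label
    exact Fintype.ofFinite _
  σ := Option α × Bool
  initialState := (none, false)
  Γk₀Fin := inferInstanceAs (Fintype α)
  -- The halting configuration required of a machine computing a function has the initial internal
  -- memory, hence the reset.
  m l := l.elim (.load (fun _ => (none, false)) .halt) (p.code some none)

/-- A program that computes a function in polynomial time yields a machine. -/
theorem Prog.computable {δ : Type} (p : Prog α β C) (enc : δ → List β) (f : List α → δ)
    (time : Polynomial ℕ)
    (h : ∀ w, ∃ n ≤ time.eval w.length,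
      Exec p ⟨w, [], fun _ => 0⟩ ⟨[], enc (f w), fun _ => 0⟩ n) :
    Nonempty (Turing.TM2ComputableInPolyTime (fun w : List α => w) enc f) := by
  choose n hn he using h
  -- The additional step is the one that resets the memory and halts.
  refine ⟨⟨⟨p.tm, Equiv.refl α, Equiv.refl β⟩, time + 1, fun w => ⟨⟨n w + 1, ?_⟩, ?_⟩⟩⟩
  · have hs : ∀ w' : List α, ((Store.mk w' [] fun _ => 0 : Store α β C)).stk =
        (Turing.initList p.tm w').stk := by
      intro w'
      funext k
      cases k <;> rfl
    have ho : ∀ o : List β, ((Store.mk [] o fun _ => 0 : Store α β C)).stk =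
        (Turing.haltList p.tm o).stk := by
      intro o
      funext k
      cases k <;> rfl
    obtain ⟨v', hv⟩ := (he w).stepsTo p.tm.m some none (fun _ => rfl) (none, false)
    have hw : List.map (Equiv.refl α).invFun w = w := List.map_id w
    have hr : List.map (Equiv.refl β).invFun (enc (f w)) = enc (f w) := List.map_id _
    refine Eq.trans ?_ (hv.trans (.one (c' := ⟨none, (none, false), Store.stk _⟩) rfl)) |>.trans ?_
    · refine congrArg (fun c => (flip bind p.tm.step)^[n w + 1] (some c)) ?_
      rw [hs]
      exact congrArg (Turing.initList p.tm) hw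
    · rw [ho]
      exact congrArg (fun l => some (Turing.haltList p.tm l)) hr.symm
  · simpa using hn w

end Compile

/-! ## Running times of programs -/

section Runs

variable {α β C : Type} [DecidableEq C]

/-- `Runs p s s' n`: started in the store `s`, the program `p` ends after at most `n` steps
in `s'`. -/
def Runs (p : Prog α β C) (s s' : Store α β C) (n : ℕ) : Prop := ∃ m ≤ n, Exec p s s' m

theorem Exec.runs {p : Prog α β C} {s s' : Store α β C} {n : ℕ} (h : Exec p s s' n) :
    Runs p s s' n := ⟨n, le_rfl, h⟩

theorem Runs.mono {p : Prog α β C} {s s' : Store α β C} {m n : ℕ} (h : Runs p s s' m)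
    (hmn : m ≤ n) : Runs p s s' n :=
  let ⟨k, hk, he⟩ := h
  ⟨k, hk.trans hmn, he⟩

theorem Runs.seq {p q : Prog α β C} {s s₁ s₂ : Store α β C} {m n : ℕ} (h : Runs p s s₁ m)
    (h' : Runs q s₁ s₂ n) : Runs (.seq p q) s s₂ (m + n) :=
  let ⟨_, hk, he⟩ := h
  let ⟨_, hk', he'⟩ := h'
  ⟨_, Nat.add_le_add hk hk', he.seq he'⟩

theorem Runs.loop_succ {c : C} {p : Prog α β C} {s s₁ s₂ : Store α β C} {k m n : ℕ}
    (hc : s.cnt c = k + 1) (h : Runs p ⟨s.inp, s.out, Function.update s.cnt c k⟩ s₁ m)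
    (h' : Runs (.loop c p) s₁ s₂ n) : Runs (.loop c p) s s₂ (1 + (m + n)) :=
  let ⟨_, hk, he⟩ := h
  let ⟨_, hk', he'⟩ := h'
  ⟨_, Nat.add_le_add_left (Nat.add_le_add hk hk') 1, he.loop_succ hc he'⟩

theorem Runs.read_cons {p : α → Prog α β C} {a : α} {i : List α} {o : List β} {f : C → ℕ}
    {s₁ s₂ : Store α β C} {m n : ℕ} (h : Runs (p a) ⟨i, o, f⟩ s₁ m)
    (h' : Runs (.read p) s₁ s₂ n) : Runs (.read p) ⟨a :: i, o, f⟩ s₂ (1 + (m + n)) :=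
  let ⟨_, hk, he⟩ := h
  let ⟨_, hk', he'⟩ := h'
  ⟨_, Nat.add_le_add_left (Nat.add_le_add hk hk') 1, he.read_cons he'⟩

/-- A loop whose counter is the number of iterations, with a bound for each iteration. -/
theorem Runs.loop {c : C} {p : Prog α β C} {m b : ℕ} (s : ℕ → Store α β C)
    (hs : ∀ i ≤ m, (s i).cnt c = m - i)
    (h : ∀ i < m,
      Runs p ⟨(s i).inp, (s i).out, Function.update (s i).cnt c (m - (i + 1))⟩ (s (i + 1)) b) :
    Runs (.loop c p) (s 0) (s m) (m * (b + 1) + 1) := by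
  -- Induction on the number `k` of iterations still to come, since `Runs.loop_succ` peels off the
  -- first one.
  have key : ∀ k ≤ m, Runs (.loop c p) (s (m - k)) (s m) (k * (b + 1) + 1) := by
    intro k
    induction k with
    | zero =>
      intro _
      simpa using (Exec.loop_zero (p := p) (by simpa using hs m le_rfl)).runs
    | succ k ih =>
      intro hk
      have h1 := h (m - (k + 1)) (by omega)
      rw [show m - (k + 1) + 1 = m - k by omega] at h1
      refine (Runs.loop_succ (k := m - (m - k)) ?_ h1 (ih (by omega))).mono ?_
      · rw [hs _ (by omega)]
        omega
      · rw [Nat.add_mul]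
        omega
  simpa using key m le_rfl

/-- Write a word. -/
def Prog.emits : List β → Prog α β C
  | [] => .skip
  | x :: l => .seq (Prog.emits l) (.emit x)

theorem Runs.emits (l : List β) (i : List α) (o : List β) (f : C → ℕ) :
    Runs (.emits l) ⟨i, o, f⟩ ⟨i, l ++ o, f⟩ (l.length + 1) := by
  induction l with
  | nil => exact Exec.skip.runs
  | cons x l ih => exact ih.seq Exec.emit.runs

/-- Perform a program a fixed number of times. -/
def Prog.times (p : Prog α β C) : ℕ → Prog α β C
  | 0 => .skip
  | n + 1 => .seq (p.times n) p

end Runs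

/-- The counters: the current row and column of a table, an auxiliary counter, the numbers of rows
and columns to be processed, and two counters used to compute a power. -/
inductive Counter : Type where
  | row | col | tmp | rows | cols | base | pow
  deriving DecidableEq

instance : Fintype Counter :=
  ⟨{.row, .col, .tmp, .rows, .cols, .base, .pow}, fun c => by cases c <;> decide⟩

/-- The values of the counters. -/
def counts (row col tmp rows cols base pow : ℕ) : Counter → ℕ
  | .row => row
  | .col => col
  | .tmp => tmp
  | .rows => rows
  | .cols => cols
  | .base => base
  | .pow => pow

section Update

variable (r c t m n b p x : ℕ)

@[simp] theorem update_row : Function.update (counts r c t m n b p) .row x =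
    counts x c t m n b p := by funext k; cases k <;> rfl

@[simp] theorem update_col : Function.update (counts r c t m n b p) .col x =
    counts r x t m n b p := by funext k; cases k <;> rfl

@[simp] theorem update_tmp : Function.update (counts r c t m n b p) .tmp x =
    counts r c x m n b p := by funext k; cases k <;> rfl

@[simp] theorem update_rows : Function.update (counts r c t m n b p) .rows x =
    counts r c t x n b p := by funext k; cases k <;> rfl

@[simp] theorem update_cols : Function.update (counts r c t m n b p) .cols x =
    counts r c t m x b p := by funext k; cases k <;> rfl

@[simp] theorem update_base : Function.update (counts r c t m n b p) .base x =
    counts r c t m n x p := by funext k; cases k <;> rfl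

@[simp] theorem update_pow : Function.update (counts r c t m n b p) .pow x =
    counts r c t m n b x := by funext k; cases k <;> rfl

end Update

/-- The words `g (m - 1)`, ..., `g 0`, concatenated. -/
def blocks {β : Type} (g : ℕ → List β) (m : ℕ) : List β := (List.range m).reverse.flatMap g

theorem blocks_succ {β : Type} (g : ℕ → List β) (m : ℕ) : blocks g (m + 1) = g m ++ blocks g m := by
  simp [blocks, List.range_succ]

-- Writing words that depend on the current row and column

section Writes

variable {α β : Type}

/-- The program `p` writes the word `g t j` if the current row and column are `t` and `j`, and
leaves the counters as they are; this takes linear time. -/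
def Writes (p : Prog α β Counter) (g : ℕ → ℕ → List β) : Prop :=
  ∃ K, ∀ i o f, f .tmp = 0 →
    Runs p ⟨i, o, f⟩ ⟨i, g (f .row) (f .col) ++ o, f⟩ (K * (f .row + f .col + 1))

/-- Output grows at the front, so the program run second contributes the left factor. It sees the
same row and column because the first one restores the counters. -/
theorem Writes.seq {p q : Prog α β Counter} {g h : ℕ → ℕ → List β} (hp : Writes p g)
    (hq : Writes q h) : Writes (.seq p q) fun t j => h t j ++ g t j := by
  obtain ⟨K, hK⟩ := hp
  obtain ⟨K', hK'⟩ := hq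
  refine ⟨K + K', fun i o f hf => ?_⟩
  rw [Nat.add_mul, List.append_assoc]
  exact (hK i o f hf).seq (hK' i _ f hf)

theorem Writes.congr {p : Prog α β Counter} {g h : ℕ → ℕ → List β} (hp : Writes p g)
    (e : ∀ t j, g t j = h t j) : Writes p h := by
  obtain rfl : g = h := funext₂ e
  exact hp

theorem Writes.emits (l : List β) : Writes (α := α) (.emits l) fun _ _ => l :=
  ⟨l.length + 1, fun i o f _ => (Runs.emits l i o f).mono (Nat.le_mul_of_pos_right _ (by omega))⟩

theorem Writes.emit (x : β) : Writes (α := α) (.emit x) fun _ _ => [x] :=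
  ⟨1, fun _ _ _ _ => Exec.emit.runs.mono (by omega)⟩

/-- Write a letter as often as a counter says. -/
def Prog.copies (x : β) (c : Counter) : Prog α β Counter :=
  .seq (.loop c (.seq (.inc .tmp) (.emit x))) (.loop .tmp (.inc c))

/-- A counter can only be read by emptying it: the first loop moves `c` to `tmp` while writing, the
second moves it back. This costs 3 and 2 steps per unit, and one step to leave each loop. -/
theorem Runs.copies (x : β) {c : Counter} (hc : c ≠ .tmp) (i : List α) (o : List β)
    {f : Counter → ℕ} (hf : f .tmp = 0) :
    Runs (.copies x c) ⟨i, o, f⟩ ⟨i, List.replicate (f c) x ++ o, f⟩ (5 * f c + 2) := by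
  have h1 := Runs.loop (c := c) (p := .seq (.inc .tmp) (.emit x)) (m := f c) (b := 2)
    (fun k => (⟨i, List.replicate k x ++ o,
      Function.update (Function.update f c (f c - k)) .tmp k⟩ : Store α β Counter))
    (by simp [Function.update_of_ne hc]) (by
      intro k hk
      have h := (Exec.inc (α := α) (i := i) (o := List.replicate k x ++ o) (c := Counter.tmp)
        (f := Function.update (Function.update (Function.update f c (f c - k)) .tmp k) c
          (f c - (k + 1)))).runs.seq (Exec.emit (x := x)).runs
      convert h using 2
      · rfl
      · funext d
        simp only [Function.update_apply]
        split_ifs <;> simp_all)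
  have h2 := Runs.loop (c := .tmp) (p := .inc c) (m := f c) (b := 1)
    (fun k => (⟨i, List.replicate (f c) x ++ o,
      Function.update (Function.update f c k) .tmp (f c - k)⟩ : Store α β Counter))
    (by simp) (by
      intro k hk
      have h := (Exec.inc (α := α) (i := i) (o := List.replicate (f c) x ++ o) (c := c)
        (f := Function.update (Function.update (Function.update f c k) .tmp (f c - k)) .tmp
          (f c - (k + 1)))).runs
      convert h using 2
      funext d
      simp only [Function.update_apply]
      split_ifs <;> simp_all)
  have e1 : Function.update (Function.update f c (f c - 0)) .tmp 0 = f := by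
    rw [Nat.sub_zero, Function.update_eq_self, ← hf, Function.update_eq_self]
  have e2 : Function.update (Function.update f c (f c)) .tmp (f c - f c) = f := by
    rw [Nat.sub_self, Function.update_eq_self, ← hf, Function.update_eq_self]
  have e3 : Function.update (Function.update f c (f c - f c)) .tmp (f c) =
      Function.update (Function.update f c 0) .tmp (f c - 0) := by
    rw [Nat.sub_self, Nat.sub_zero]
  rw [e1, e3] at h1
  rw [e2] at h2
  exact (h1.seq h2).mono (by omega)

theorem Writes.copies_row (x : β) :
    Writes (α := α) (.copies x .row) fun t _ => List.replicate t x :=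
  ⟨5, fun i o f hf => (Runs.copies x (by decide) i o hf).mono (by omega)⟩

theorem Writes.copies_col (x : β) :
    Writes (α := α) (.copies x .col) fun _ j => List.replicate j x :=
  ⟨5, fun i o f hf => (Runs.copies x (by decide) i o hf).mono (by omega)⟩

end Writes

/-! ## Conditions as Boolean formulas -/

namespace Cond

variable {X Y : Type}

/-- The truth value of a condition, read as a Boolean formula. -/
def Eval (b : X → Prop) : Cond X → Prop
  | eq x => b x
  | ne x => ¬ b x
  | not c => ¬ c.Eval b
  | and c c' => c.Eval b ∧ c'.Eval b
  | or c c' => c.Eval b ∨ c'.Eval b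

/-- Once the tested data value is fixed, a valuation acts as a truth assignment. The two kinds of
tests are complementary even where the valuation is undefined. -/
theorem sat_iff_eval {D : Type} (d : D) (ν : X → Option D) (c : Cond X) :
    c.Sat d ν ↔ c.Eval fun x => ν x = some d := by
  induction c with
  | eq x | ne x => rfl
  | not c ih => exact not_congr ih
  | and c c' ih ih' => exact and_congr ih ih'
  | or c c' ih ih' => exact or_congr ih ih'

theorem eval_congr {b b' : X → Prop} (c : Cond X) (h : ∀ x ∈ c.vars, b x ↔ b' x) :
    c.Eval b ↔ c.Eval b' := by
  induction c with
  | eq x => exact h x rfl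
  | ne x => exact not_congr (h x rfl)
  | not c ih => exact not_congr (ih h)
  | and c c' ih ih' =>
    exact and_congr (ih fun x hx => h x (.inl hx)) (ih' fun x hx => h x (.inr hx))
  | or c c' ih ih' =>
    exact or_congr (ih fun x hx => h x (.inl hx)) (ih' fun x hx => h x (.inr hx))

/-- Renaming of variables. -/
def map (g : X → Y) : Cond X → Cond Y
  | eq x => .eq (g x)
  | ne x => .ne (g x)
  | not c => .not (c.map g)
  | and c c' => .and (c.map g) (c'.map g)
  | or c c' => .or (c.map g) (c'.map g)

theorem eval_map (g : X → Y) (b : Y → Prop) (c : Cond X) :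
    (c.map g).Eval b ↔ c.Eval (b ∘ g) := by
  induction c with
  | eq x | ne x => rfl
  | not c ih => exact not_congr ih
  | and c c' ih ih' => exact and_congr ih ih'
  | or c c' ih ih' => exact or_congr ih ih'

theorem vars_map (g : X → Y) (c : Cond X) : (c.map g).vars = g '' c.vars := by
  induction c with
  | eq x | ne x => simp [map, vars]
  | not c ih => exact ih
  | and c c' ih ih' | or c c' ih ih' => simp [map, vars, ih, ih', Set.image_union]

/-- Conjunction of a list of conditions. -/
def conj (cs : List (Cond X)) (c : Cond X) : Cond X := cs.foldr .and c

theorem eval_conj (b : X → Prop) (cs : List (Cond X)) (c : Cond X) :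
    (conj cs c).Eval b ↔ (∀ c' ∈ cs, c'.Eval b) ∧ c.Eval b := by
  induction cs with
  | nil => simp [conj]
  | cons c' cs ih =>
    rw [List.forall_mem_cons, and_assoc, ← ih]
    rfl

theorem mem_vars_conj {x : X} {cs : List (Cond X)} {c : Cond X} (hx : x ∈ (conj cs c).vars) :
    (∃ c' ∈ cs, x ∈ c'.vars) ∨ x ∈ c.vars := by
  induction cs with
  | nil => exact .inr hx
  | cons c' cs ih =>
    rcases hx with hx | hx
    · exact .inl ⟨c', List.mem_cons_self, hx⟩
    · rcases ih hx with ⟨c'', hc, hx⟩ | hx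
      · exact .inl ⟨c'', List.mem_cons_of_mem _ hc, hx⟩
      · exact .inr hx

/-- `Definable f`: the Boolean function `f` is given by a condition. -/
def Definable (f : (X → Prop) → Prop) : Prop := ∃ c : Cond X, ∀ b, c.Eval b ↔ f b

theorem Definable.not {f : (X → Prop) → Prop} (h : Definable f) : Definable fun b => ¬ f b := by
  obtain ⟨c, hc⟩ := h
  exact ⟨.not c, fun b => not_congr (hc b)⟩

theorem Definable.and {f g : (X → Prop) → Prop} (h : Definable f) (h' : Definable g) :
    Definable fun b => f b ∧ g b := by
  obtain ⟨c, hc⟩ := h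
  obtain ⟨c', hc'⟩ := h'
  exact ⟨.and c c', fun b => and_congr (hc b) (hc' b)⟩

/-- Conditions have no constants; `x⁼ ∨ x^≠` and `x⁼ ∧ x^≠` replace them, which requires a variable
to exist. -/
theorem definable_const [Nonempty X] (p : Prop) : Definable fun _ : X → Prop => p := by
  obtain ⟨x⟩ := ‹Nonempty X›
  by_cases hp : p
  · exact ⟨.or (.eq x) (.ne x), fun b => iff_of_true (em (b x)) hp⟩
  · exact ⟨.and (.eq x) (.ne x), fun b => iff_of_false (and_not_self (a := b x)) hp⟩

theorem Definable.forall_mem [Nonempty X] {ι : Type} {f : ι → (X → Prop) → Prop} (l : List ι)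
    (h : ∀ i, Definable (f i)) : Definable fun b => ∀ i ∈ l, f i b := by
  induction l with
  | nil => simpa using definable_const True
  | cons i l ih => simpa using (h i).and ih

theorem Definable.forall [Nonempty X] {ι : Type} [Finite ι] {f : ι → (X → Prop) → Prop}
    (h : ∀ i, Definable (f i)) : Definable fun b => ∀ i, f i b := by
  have := Fintype.ofFinite ι
  simpa using Definable.forall_mem Finset.univ.toList h

/-- Every Boolean function of finitely many variables is given by a condition. -/
theorem definable [Nonempty X] [Finite X] (f : (X → Prop) → Prop) : Definable f := by
  -- Conjunctive normal form: each falsifying assignment `g` is excluded by one clause.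
  have h : Definable fun b : X → Prop => ∀ g : X → Prop, ¬ ((∀ x, b x ↔ g x) ∧ ¬ f g) := by
    refine Definable.forall fun g => (Definable.and (Definable.forall fun x => ?_)
      (definable_const _)).not
    by_cases hg : g x
    · exact ⟨.eq x, fun b => (iff_true_right hg).symm⟩
    · exact ⟨.ne x, fun b => (iff_false_right hg).symm⟩
  obtain ⟨c, hc⟩ := h
  refine ⟨c, fun b => (hc b).trans ⟨fun H => ?_, fun H g hg => ?_⟩⟩
  · by_contra hf
    exact H b ⟨fun _ => Iff.rfl, hf⟩
  · obtain rfl : b = g := funext fun x => propext (hg.1 x)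
    exact hg.2 H

end Cond

/-! ## Names of variables -/

section Names

variable {S : Type} [Finite S]

/-- A name for an element of a finite set. -/
noncomputable def tag (s : S) : Name := List.replicate (Finite.equivFin S s) true

/-- The name of the variable for `s` in row `t` and column `j`. -/
noncomputable def varName (t j : ℕ) (s : S) : Name :=
  List.replicate t true ++ false :: (List.replicate j true ++ false :: tag s)

/-- The words `1ᵐ0` form a prefix code. -/
theorem replicate_true_inj {m n : ℕ} {x y : List Bool}
    (h : List.replicate m true ++ false :: x = List.replicate n true ++ false :: y) :
    m = n ∧ x = y := by
  induction m generalizing n with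
  | zero => cases n <;> simp_all [List.replicate_succ]
  | succ m ih =>
    cases n with
    | zero => simp [List.replicate_succ] at h
    | succ n =>
      simp only [List.replicate_succ, List.cons_append, List.cons.injEq, true_and] at h
      simpa using ih h

theorem varName_inj {t t' j j' : ℕ} {s s' : S} (h : varName t j s = varName t' j' s') :
    t = t' ∧ j = j' ∧ s = s' := by
  obtain ⟨ht, h⟩ := replicate_true_inj h
  obtain ⟨hj, h⟩ := replicate_true_inj h
  have hs := congrArg List.length h
  simp only [tag, List.length_replicate] at hs
  exact ⟨ht, hj, (Finite.equivFin S).injective (Fin.ext hs)⟩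

/-- The variables used to describe a window of a table: they belong to the current row or the next
one, and to the first column (`none`), the current column or the next one. -/
abbrev Slot (S : Type) : Type := Bool × Option Bool × S

/-- The name of a window variable if the window is at row `t` and column `j`. -/
noncomputable def place (t j : ℕ) (v : Slot S) : Name :=
  varName (t + v.1.toNat) (v.2.1.elim 0 fun b => j + b.toNat) v.2.2

theorem encName_append {A : Type} (x y : Name) :
    (encName (x ++ y) : List (Token A)) = x.map (fun b => mk (.bit b)) ++ encName y := by
  induction x with
  | nil => rfl
  | cons b x ih => exact congrArg _ ih

variable {A α : Type}

/-- Write the name of a window variable. -/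
noncomputable def writeVar (v : Slot S) : Prog α (Token A) Counter :=
  .seq (.emits (mk (.bit false) :: encName (tag v.2.2)))
    (.seq (v.2.1.elim .skip fun b => .seq (.copies (mk (.bit true)) .col)
        (.emits (List.replicate b.toNat (mk (.bit true)))))
      (.seq (.seq (.emit (mk (.bit false))) (.copies (mk (.bit true)) .row))
        (.emits (List.replicate v.1.toNat (mk (.bit true))))))

/-- The name lists row, column and tag from left to right, so they are written in the opposite
order. The tag and the offsets of the slot are constants of the program. -/
theorem Writes.writeVar (v : Slot S) :
    Writes (writeVar v : Prog α (Token A) Counter) fun t j => encName (place t j v) := by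
  obtain ⟨d, c, s⟩ := v
  have h : Writes (α := α) (β := Token A) (c.elim .skip fun b => .seq (.copies (mk (.bit true)) .col)
      (.emits (List.replicate b.toNat (mk (.bit true))))) fun _ j =>
        List.replicate (c.elim 0 fun b => j + b.toNat) (mk (.bit true)) := by
    cases c with
    | none => exact ⟨1, fun i o f _ => Exec.skip.runs.mono (by omega)⟩
    | some b =>
      refine ((Writes.copies_col (mk (.bit true))).seq (.emits _)).congr fun t j => ?_
      rw [← List.replicate_add, Nat.add_comm]
      rfl
  refine ((Writes.emits _).seq (h.seq (((Writes.emit _).seq (.copies_row _)).seq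
    (.emits _)))).congr fun t j => ?_
  simp only [place, varName, encName_append, encName, List.map_replicate, Nat.add_comm t,
    List.replicate_add, List.append_assoc, List.cons_append, List.nil_append]

/-- Write a condition on window variables. -/
noncomputable def writeCond : Cond (Slot S) → Prog α (Token A) Counter
  | .eq v => .seq (writeVar v) (.emit (mk .eq))
  | .ne v => .seq (writeVar v) (.emit (mk .ne))
  | .not c => .seq (writeCond c) (.emit (mk .not))
  | .and c c' => .seq (writeCond c') (.seq (writeCond c) (.emit (mk .and)))
  | .or c c' => .seq (writeCond c') (.seq (writeCond c) (.emit (mk .or)))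

theorem Writes.writeCond (c : Cond (Slot S)) :
    Writes (writeCond c : Prog α (Token A) Counter) fun t j => encCond (c.map (place t j)) := by
  induction c with
  | eq v | ne v => exact (Writes.writeVar v).seq (.emit _)
  | not c ih => exact ih.seq (.emit _)
  | and c c' ih ih' | or c c' ih ih' =>
    exact (ih'.seq (ih.seq (.emit _))).congr fun t j => by simp [Cond.map, encCond]

/-- Write a list of bindings. -/
noncomputable def writeBinds (a : A) : List S → Prog α (Token A) Counter
  | [] => .emits []
  | s :: l => .seq (writeBinds a l)
      (.seq (writeVar (false, some false, s)) (.emits [mk .bind, Sum.inr a]))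

theorem Writes.writeBinds (a : A) (l : List S) :
    Writes (writeBinds a l : Prog α (Token A) Counter) fun t j =>
      l.flatMap fun s => mk .bind :: Sum.inr a :: encName (varName t j s) := by
  induction l with
  | nil => exact .emits []
  | cons s l ih =>
    exact (ih.seq ((Writes.writeVar _).seq (.emits _))).congr fun t j => by simp [place]

end Names

/-! ## The program of the reduction -/

section Program

variable {α β : Type}

theorem Runs.inc {C : Type} [DecidableEq C] {c : C} {i : List α} {o : List β} {f f' : C → ℕ}
    (h : Function.update f c (f c + 1) = f') : Runs (.inc c) ⟨i, o, f⟩ ⟨i, o, f'⟩ 1 := by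
  subst h
  exact Exec.inc.runs

theorem Runs.times {C : Type} [DecidableEq C] {p : Prog α β C} {k b : ℕ} (s : ℕ → Store α β C)
    (h : ∀ i < k, Runs p (s i) (s (i + 1)) b) : Runs (p.times k) (s 0) (s k) (k * b + 1) := by
  induction k with
  | zero => exact Exec.skip.runs.mono (by omega)
  | succ k ih =>
    refine ((ih fun i hi => h i (hi.trans (Nat.lt_succ_self k))).seq
      (h k (Nat.lt_succ_self k))).mono ?_
    rw [Nat.add_mul]
    omega

/-- Run through a table of `rows` rows and `cols` columns. -/
def Prog.grid (p : Prog α β Counter) : Prog α β Counter :=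
  .loop .rows (.seq (.loop .cols (.seq p (.inc .col))) (.seq (.loop .col (.inc .cols)) (.inc .row)))

/-- The inner loop turns `cols` into `col`, and the loop after it turns `col` back, so each row
finds the full width. The counter `rows` is consumed and ends up in `row`, where it serves to write
the condition on the last row. -/
theorem Runs.grid {p : Prog α β Counter} {g : ℕ → ℕ → List β} (hp : Writes p g) :
    ∃ K, ∀ T J i o b q, Runs (.grid p) ⟨i, o, counts 0 0 0 T J b q⟩
      ⟨i, blocks (fun t => blocks (g t) J) T ++ o, counts T 0 0 0 J b q⟩
      (T * (J * (K * (T + J + 1) + 4) + 4) + 1) := by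
  obtain ⟨K, hK⟩ := hp
  refine ⟨K, fun T J i o b q => ?_⟩
  have inner : ∀ t < T, ∀ m o, Runs (.loop .cols (.seq p (.inc .col)))
      ⟨i, o, counts t 0 0 m J b q⟩ ⟨i, blocks (g t) J ++ o, counts t J 0 m 0 b q⟩
      (J * (K * (T + J + 1) + 1 + 1) + 1) := by
    intro t ht m o
    have h := Runs.loop (c := .cols) (p := .seq p (.inc .col)) (m := J)
      (b := K * (T + J + 1) + 1)
      (fun j => (⟨i, blocks (g t) j ++ o, counts t j 0 m (J - j) b q⟩ : Store α β Counter))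
      (fun j hj => rfl) (by
        intro j hj
        rw [update_cols, blocks_succ, List.append_assoc]
        have h1 := (hK i (blocks (g t) j ++ o) (counts t j 0 m (J - (j + 1)) b q) rfl).mono
          (Nat.mul_le_mul_left K (show t + j + 1 ≤ T + J + 1 by omega))
        exact h1.seq (.inc (update_col ..)))
    rw [Nat.sub_self, Nat.sub_zero] at h
    exact h
  have back : ∀ t m o, Runs (.loop .col (.inc .cols))
      ⟨i, o, counts t J 0 m 0 b q⟩ (⟨i, o, counts t 0 0 m J b q⟩ : Store α β Counter)
      (J * (1 + 1) + 1) := by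
    intro t m o
    have h := Runs.loop (c := .col) (p := .inc .cols) (m := J) (b := 1)
      (fun j => (⟨i, o, counts t (J - j) 0 m j b q⟩ : Store α β Counter))
      (fun j hj => rfl) (by
        intro j hj
        rw [update_col]
        exact .inc (update_cols ..))
    rw [Nat.sub_self, Nat.sub_zero] at h
    exact h
  have h := Runs.loop (c := .rows)
    (p := .seq (.loop .cols (.seq p (.inc .col))) (.seq (.loop .col (.inc .cols)) (.inc .row)))
    (m := T) (b := J * (K * (T + J + 1) + 4) + 3)
    (fun t => (⟨i, blocks (fun t => blocks (g t) J) t ++ o, counts t 0 0 (T - t) J b q⟩ :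
      Store α β Counter)) (fun t ht => rfl) (by
      intro t ht
      rw [update_rows, blocks_succ, List.append_assoc]
      have h1 := (inner t ht (T - (t + 1)) (blocks (fun t => blocks (g t) J) t ++ o)).seq
        ((back t _ _).seq (.inc (update_row ..)))
      refine h1.mono ?_
      have e : J * (K * (T + J + 1) + 4) = J * (K * (T + J + 1) + 1 + 1) + J * 2 := by ring
      omega)
  rw [Nat.sub_self, Nat.sub_zero] at h
  exact h

/-- Set the counter `pow` to the `k`-th power of `base + k`. -/
def Prog.power (k : ℕ) : Prog α β Counter :=
  .seq (.times (.inc .base) k) (.seq (.inc .pow)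
    (.times (.seq (.loop .pow (.inc .tmp)) (.loop .tmp (.seq
      (.loop .base (.seq (.inc .pow) (.inc .rows))) (.loop .rows (.inc .base))))) k))

/-- To multiply `pow` by `base`, `pow` is moved to `tmp`, and for each unit of `tmp` the value of
`base` is added to `pow`, with `rows` as the scratch counter from which `base` is restored. -/
theorem Runs.power (k n c : ℕ) (i : List α) (o : List β) :
    Runs (.power k) ⟨i, o, counts 0 c 0 0 0 n 0⟩ ⟨i, o, counts 0 c 0 0 0 (n + k) ((n + k) ^ k)⟩
      (k + k * ((n + k) ^ k * (5 * (n + k) + 5) + 2) + 3) := by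
  have h1 := Runs.times (p := .inc .base) (k := k) (b := 1)
    (fun m => (⟨i, o, counts 0 c 0 0 0 (n + m) 0⟩ : Store α β Counter)) (by
      intro m hm
      exact .inc (update_base ..))
  have h2 : Runs (.inc .pow) ⟨i, o, counts 0 c 0 0 0 (n + k) 0⟩
      (⟨i, o, counts 0 c 0 0 0 (n + k) 1⟩ : Store α β Counter) 1 := .inc (update_pow ..)
  have hm : k ≤ n + k := Nat.le_add_left k n
  generalize n + k = m at *
  have h3 : ∀ q, Runs (.loop .pow (.inc .tmp)) ⟨i, o, counts 0 c 0 0 0 m q⟩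
      (⟨i, o, counts 0 c q 0 0 m 0⟩ : Store α β Counter) (q * (1 + 1) + 1) := by
    intro q
    have h := Runs.loop (c := .pow) (p := .inc .tmp) (m := q) (b := 1)
      (fun j => (⟨i, o, counts 0 c j 0 0 m (q - j)⟩ : Store α β Counter))
      (fun j hj => rfl) (by
        intro j hj
        rw [update_pow]
        exact .inc (update_tmp ..))
    rw [Nat.sub_self, Nat.sub_zero] at h
    exact h
  have h4 : ∀ t q, Runs (.loop .base (.seq (.inc .pow) (.inc .rows)))
      ⟨i, o, counts 0 c t 0 0 m q⟩ (⟨i, o, counts 0 c t m 0 0 (q + m)⟩ : Store α β Counter)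
      (m * (2 + 1) + 1) := by
    intro t q
    have h := Runs.loop (c := .base) (p := .seq (.inc .pow) (.inc .rows)) (m := m) (b := 2)
      (fun j => (⟨i, o, counts 0 c t j 0 (m - j) (q + j)⟩ : Store α β Counter))
      (fun j hj => rfl) (by
        intro j hj
        rw [update_base]
        exact (Runs.inc (update_pow ..)).seq (.inc (update_rows ..)))
    rw [Nat.sub_self, Nat.sub_zero] at h
    exact h
  have h5 : ∀ t q, Runs (.loop .rows (.inc .base))
      ⟨i, o, counts 0 c t m 0 0 q⟩ (⟨i, o, counts 0 c t 0 0 m q⟩ : Store α β Counter)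
      (m * (1 + 1) + 1) := by
    intro t q
    have h := Runs.loop (c := .rows) (p := .inc .base) (m := m) (b := 1)
      (fun j => (⟨i, o, counts 0 c t (m - j) 0 j q⟩ : Store α β Counter))
      (fun j hj => rfl) (by
        intro j hj
        rw [update_rows]
        exact .inc (update_base ..))
    rw [Nat.sub_self, Nat.sub_zero] at h
    exact h
  have h6 : ∀ q, Runs (.loop .tmp (.seq
      (.loop .base (.seq (.inc .pow) (.inc .rows))) (.loop .rows (.inc .base))))
      ⟨i, o, counts 0 c q 0 0 m 0⟩ (⟨i, o, counts 0 c 0 0 0 m (q * m)⟩ : Store α β Counter)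
      (q * (m * (2 + 1) + 1 + (m * (1 + 1) + 1) + 1) + 1) := by
    intro q
    have h := Runs.loop (c := .tmp) (p := .seq
      (.loop .base (.seq (.inc .pow) (.inc .rows))) (.loop .rows (.inc .base))) (m := q)
      (b := m * (2 + 1) + 1 + (m * (1 + 1) + 1))
      (fun j => (⟨i, o, counts 0 c (q - j) 0 0 m (j * m)⟩ : Store α β Counter))
      (fun j hj => rfl) (by
        intro j hj
        rw [update_tmp, Nat.add_mul, Nat.one_mul]
        exact (h4 _ _).seq (h5 _ _))
    rw [Nat.sub_self, Nat.sub_zero, Nat.zero_mul] at h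
    exact h
  have h7 := Runs.times (k := k) (b := m ^ k * (5 * m + 5) + 2)
    (fun e => (⟨i, o, counts 0 c 0 0 0 m (m ^ e)⟩ : Store α β Counter)) (by
      intro e he
      rw [pow_succ]
      refine ((h3 (m ^ e)).seq (h6 (m ^ e))).mono ?_
      -- Bounding the intermediate powers by the last one makes the cost of a round uniform; `m` is
      -- positive because `e < k ≤ m`.
      have hle : m ^ e ≤ m ^ k := Nat.pow_le_pow_right (by omega) he.le
      have := Nat.mul_le_mul_right (5 * m + 5) hle
      have e1 : m ^ e * (m * (2 + 1) + 1 + (m * (1 + 1) + 1) + 1) + m ^ e * (1 + 1) =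
        m ^ e * (5 * m + 5) := by ring
      omega)
  rw [pow_zero] at h7
  exact (h1.seq (h2.seq h7)).mono (by omega)

/-- Perform a program for each letter of the input, and count the letters. -/
def Prog.forInput (p : α → Prog α β Counter) : Prog α β Counter :=
  .read fun a => .seq (p a) (.seq (.inc .col) (.inc .base))

/-- The letters are counted twice: `col` is the position of the current letter and finally the first
blank column, while `base` is the input length from which the height is computed. Summing the
constants over the finite alphabet gives one constant for all letters. -/
theorem Runs.forInput [Finite α] {p : α → Prog α β Counter} {g : α → ℕ → ℕ → List β}
    (hp : ∀ a, Writes (p a) (g a)) : ∃ K, ∀ w o, Runs (.forInput p)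
      ⟨w, o, counts 0 0 0 0 0 0 0⟩
      ⟨[], (w.zipIdx.reverse.flatMap fun x => g x.1 0 x.2) ++ o,
        counts 0 w.length 0 0 0 w.length 0⟩
      (w.length * (K * (w.length + 1) + 3) + 1) := by
  have := Fintype.ofFinite α
  choose K hK using hp
  refine ⟨∑ a, K a, fun w o => ?_⟩
  have key : ∀ (v : List α) (m : ℕ) (o : List β), m + v.length = w.length →
      Runs (.forInput p) ⟨v, o, counts 0 m 0 0 0 m 0⟩
      ⟨[], ((v.zipIdx m).reverse.flatMap fun x => g x.1 0 x.2) ++ o,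
        counts 0 w.length 0 0 0 w.length 0⟩
      (v.length * ((∑ a, K a) * (w.length + 1) + 3) + 1) := by
    intro v
    induction v with
    | nil =>
      intro m o hm
      obtain rfl : m = w.length := hm
      simpa [Prog.forInput] using (Exec.read_nil (p := fun a => .seq (p a) (.seq (.inc .col) (.inc .base)))
        rfl).runs
    | cons a v ih =>
      intro m o hm
      rw [List.length_cons] at hm
      have h1 := (hK a v o (counts 0 m 0 0 0 m 0) rfl).mono (Nat.mul_le_mul
        (Finset.single_le_sum (f := K) (fun _ _ => Nat.zero_le _) (Finset.mem_univ a))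
        (show 0 + m + 1 ≤ w.length + 1 by omega))
      have h2 := h1.seq ((Runs.inc (update_col ..)).seq (.inc (update_base ..)))
      have h3 := h2.read_cons (p := fun a => .seq (p a) (.seq (.inc .col) (.inc .base)))
        (ih (m + 1) _ (by omega))
      simp only [List.zipIdx_cons, List.reverse_cons, List.flatMap_append, List.flatMap_cons,
        List.flatMap_nil, List.append_nil, List.append_assoc, List.length_cons]
      refine h3.mono ?_
      rw [Nat.add_mul]
      omega
  simpa using key w 0 o (by omega)

/-- Perform a program `pow` times, in successive columns. -/
def Prog.pad (p : Prog α β Counter) : Prog α β Counter :=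
  .seq (.loop .pow (.seq p (.seq (.inc .col) (.inc .rows)))) (.loop .col (.inc .cols))

/-- Besides filling the blank columns `n, …, n + T - 1`, this sets `rows` to `T` and `cols` to `n +
T`, as `Prog.grid` expects. -/
theorem Runs.pad {p : Prog α β Counter} {g : ℕ → ℕ → List β} (hp : Writes p g) :
    ∃ K, ∀ n T i o b, Runs (.pad p) ⟨i, o, counts 0 n 0 0 0 b T⟩
      ⟨i, blocks (fun j => g 0 (n + j)) T ++ o, counts 0 0 0 T (n + T) b 0⟩
      (T * (K * (n + T + 1) + 5) + 2 * n + 2) := by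
  obtain ⟨K, hK⟩ := hp
  refine ⟨K, fun n T i o b => ?_⟩
  have h1 := Runs.loop (c := .pow) (p := .seq p (.seq (.inc .col) (.inc .rows))) (m := T)
    (b := K * (n + T + 1) + 2)
    (fun j => (⟨i, blocks (fun j => g 0 (n + j)) j ++ o, counts 0 (n + j) 0 j 0 b (T - j)⟩ :
      Store α β Counter)) (fun j hj => rfl) (by
      intro j hj
      rw [update_pow, blocks_succ, List.append_assoc]
      have h1 := (hK i (blocks (fun j => g 0 (n + j)) j ++ o)
        (counts 0 (n + j) 0 j 0 b (T - (j + 1))) rfl).mono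
        (Nat.mul_le_mul_left K (show 0 + (n + j) + 1 ≤ n + T + 1 by omega))
      exact h1.seq ((Runs.inc (update_col ..)).seq (.inc (update_rows ..))))
  have h2 := Runs.loop (c := .col) (p := .inc .cols) (m := n + T) (b := 1)
    (fun j => (⟨i, blocks (fun j => g 0 (n + j)) T ++ o, counts 0 (n + T - j) 0 T j b 0⟩ :
      Store α β Counter)) (fun j hj => rfl) (by
      intro j hj
      rw [update_col]
      exact .inc (update_cols ..))
  rw [Nat.sub_self, Nat.sub_zero] at h1 h2
  refine (h1.seq h2).mono ?_
  rw [Nat.mul_add T, Nat.mul_add T, Nat.mul_add T]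
  omega

/-- Reset a counter. -/
theorem Runs.clear {c : Counter} {i : List α} {o : List β} {f f' : Counter → ℕ}
    (hf : Function.update f c 0 = f') :
    Runs (.loop c .skip) ⟨i, o, f⟩ ⟨i, o, f'⟩ (2 * f c + 1) := by
  subst hf
  have h := Runs.loop (c := c) (p := .skip) (m := f c) (b := 1)
    (fun j => (⟨i, o, Function.update f c (f c - j)⟩ : Store α β Counter))
    (by simp) (by
      intro j hj
      simpa using (Exec.skip (s := (⟨i, o, Function.update f c (f c - (j + 1))⟩ :
        Store α β Counter))).runs)
  rw [Nat.sub_self, Nat.sub_zero, Function.update_eq_self] at h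
  exact h.mono (by omega)

end Program

open Polynomial in
/-- The program `p` leads from the store `s w` to the store `s' w` in time polynomial in the length
of `w`. -/
def PolyRuns {α β : Type} (p : Prog α β Counter) (s s' : List α → Store α β Counter) : Prop :=
  ∃ P : ℕ[X], ∀ w, Runs p (s w) (s' w) (P.eval w.length)

theorem PolyRuns.of_eval {α β : Type} {p : Prog α β Counter} {s s' : List α → Store α β Counter}
    {t : List α → ℕ} (h : ∀ w, Runs p (s w) (s' w) (t w)) (P : Polynomial ℕ)
    (hP : ∀ w, P.eval w.length = t w) : PolyRuns p s s' :=
  ⟨P, fun w => hP w ▸ h w⟩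

theorem PolyRuns.seq {α β : Type} {p q : Prog α β Counter} {s s₁ s₂ : List α → Store α β Counter}
    (h : PolyRuns p s s₁) (h' : PolyRuns q s₁ s₂) : PolyRuns (.seq p q) s s₂ := by
  obtain ⟨P, hP⟩ := h
  obtain ⟨Q, hQ⟩ := h'
  refine ⟨P + Q, fun w => ?_⟩
  rw [Polynomial.eval_add]
  exact (hP w).seq (hQ w)

theorem PolyRuns.inc {α β : Type} {c : Counter} {i : List α → List α} {o : List α → List β}
    {f f' : List α → Counter → ℕ} (h : ∀ w, Function.update (f w) c (f w c + 1) = f' w) :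
    PolyRuns (.inc c) (fun w => ⟨i w, o w, f w⟩) (fun w => ⟨i w, o w, f' w⟩) :=
  .of_eval (fun w => Runs.inc (h w)) 1 (by simp)

theorem PolyRuns.emits {α β : Type} (l : List β) {i : List α → List α} {o : List α → List β}
    {f : List α → Counter → ℕ} :
    PolyRuns (.emits l) (fun w => ⟨i w, o w, f w⟩) (fun w => ⟨i w, l ++ o w, f w⟩) :=
  .of_eval (fun w => Runs.emits l (i w) (o w) (f w)) (l.length + 1) (by simp)

open Polynomial in
theorem PolyRuns.writes {α β : Type} {p : Prog α β Counter} {g : ℕ → ℕ → List β} (hp : Writes p g)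
    {i : List α → List α} {o : List α → List β} {f : List α → Counter → ℕ}
    (h0 : ∀ w, f w .tmp = 0) (R C : ℕ[X]) (hR : ∀ w, f w .row = R.eval w.length)
    (hC : ∀ w, f w .col = C.eval w.length) :
    PolyRuns p (fun w => ⟨i w, o w, f w⟩)
      (fun w => ⟨i w, g (f w .row) (f w .col) ++ o w, f w⟩) := by
  obtain ⟨K, hK⟩ := hp
  exact .of_eval (fun w => hK (i w) (o w) (f w) (h0 w)) ((K : ℕ[X]) * (R + C + 1))
    (by simp [hR, hC])

/-- The parts of the description of a table by conditions on windows: what holds at a letter of the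
input, at the blank part of the first row, everywhere, and at the last row; and a condition that
always holds. -/
structure TableSpec (S : Type) : Type where
  init : Bool → Cond (Slot S)
  blank : Cond (Slot S)
  win : Cond (Slot S)
  acc : Cond (Slot S)
  triv : Cond (Slot S)

-- The instance and the program that writes it

section Reduction

variable {A S : Type} [Finite S] (a : A) (F : TableSpec S) (k : ℕ)

/-- A list of the elements of a finite type. -/
noncomputable def elems (S : Type) [Finite S] : List S :=
  (Set.finite_univ (α := S)).toFinset.toList

theorem mem_elems (s : S) : s ∈ elems S := by simp [elems]

/-- The number of rows of the table. -/
def height (k : ℕ) (w : List Bool) : ℕ := (w.length + k) ^ k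

/-- The number of columns of the table. -/
def width (k : ℕ) (w : List Bool) : ℕ := w.length + height k w

/-- The conditions that the table has to satisfy. -/
noncomputable def tableConds (w : List Bool) : List (Cond Name) :=
  F.acc.map (place (height k w) 0) ::
    (((List.range (height k w)).reverse.flatMap fun t =>
      (List.range (width k w)).reverse.map fun j => F.win.map (place t j)) ++
    ((List.range (height k w)).reverse.map fun j => F.blank.map (place 0 (w.length + j))) ++
    w.zipIdx.reverse.map fun x => (F.init x.1).map (place 0 x.2))

/-- The variables of the table. -/
noncomputable def tableVars (S : Type) [Finite S] (k : ℕ) (w : List Bool) : List Name :=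
  (List.range (height k w + 2)).reverse.flatMap fun t =>
    (List.range (width k w + 1)).reverse.flatMap fun j => (elems S).map (varName t j)

/-- Bind all variables of a list, then test a condition. -/
def bindTest (a : A) (xs : List Name) (c : Cond Name) : REWB A Name :=
  xs.foldr (.bind a) (.test a c)

/-- An instance with one vertex and two loops at it. -/
def loopInstance (a : A) (e : REWB A Name) : RawInstance A where
  vertices := [[]]
  edges := [([], a, [false], []), ([], a, [true], [])]
  expr := e
  valuation := []
  source := []
  target := []

/-- The instance that asks for a table. -/
noncomputable def tableInstance (w : List Bool) : RawInstance A :=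
  loopInstance a (bindTest a (tableVars S k w)
    (.conj (tableConds F k w) (F.triv.map (place 0 0))))

theorem encCond_conj (cs : List (Cond Name)) (c : Cond Name) :
    (encCond (.conj cs c) : List (Token A)) =
      cs.flatMap (fun c => mk .and :: encCond c) ++ encCond c := by
  induction cs with
  | nil => rfl
  | cons c' cs ih =>
    rw [List.flatMap_cons, List.append_assoc, ← ih]
    rfl

theorem encExpr_bindTest (xs : List Name) (c : Cond Name) :
    encExpr (bindTest a xs c) =
      xs.flatMap (fun x => mk .bind :: Sum.inr a :: encName x) ++
        ([mk .test, Sum.inr a] ++ encCond c) := by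
  induction xs with
  | nil => rfl
  | cons x xs ih =>
    rw [List.flatMap_cons, List.append_assoc, ← ih]
    simp [bindTest, encExpr]

/-- The beginning of the word that describes an instance. -/
def openTokens : List (Token A) :=
  encList encName [[]] ++ encList encEdge [([], a, [false], []), ([], a, [true], [])]

/-- The end of the word that describes an instance. -/
def closeTokens : List (Token A) := encList encPair [] ++ (encName [] ++ encName [])

theorem encRaw_loopInstance (e : REWB A Name) :
    encRaw (loopInstance a e) = openTokens a ++ (encExpr e ++ closeTokens) := by
  simp [encRaw, loopInstance, openTokens, closeTokens]

/-- Write a condition to be added to a conjunction. -/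
noncomputable def writeConj (c : Cond (Slot S)) : Prog Bool (Token A) Counter :=
  .seq (writeCond c) (.emit (mk .and))

theorem Writes.writeConj (c : Cond (Slot S)) :
    Writes (writeConj c : Prog Bool (Token A) Counter) fun t j =>
      mk .and :: encCond (c.map (place t j)) :=
  (Writes.writeCond c).seq (.emit _)

/-- The program that computes the instance. -/
noncomputable def tableProg : Prog Bool (Token A) Counter :=
  .seq (.emits closeTokens) <| .seq (writeCond F.triv) <|
  .seq (.forInput fun b => writeConj (F.init b)) <| .seq (.power k) <|
  .seq (.pad (writeConj F.blank)) <| .seq (.grid (writeConj F.win)) <|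
  .seq (writeConj F.acc) <| .seq (.emits [mk .test, Sum.inr a]) <|
  .seq (.loop .row (.inc .rows)) <| .seq (.inc .rows) <| .seq (.inc .rows) <|
  .seq (.inc .cols) <| .seq (.grid (writeBinds a (elems S))) <| .seq (.emits (openTokens a)) <|
  .seq (.loop .row .skip) <| .seq (.loop .cols .skip) (.loop .base .skip)

open Polynomial in
/-- The height of the table as a polynomial in the length of the input. -/
noncomputable def heightPoly : ℕ[X] := (X + (k : ℕ[X])) ^ k

@[simp]
theorem eval_heightPoly (w : List Bool) : (heightPoly k).eval w.length = height k w := by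
  simp [heightPoly, height]

/-- The tile set, the window conditions and `k` are built into the program; only the counters depend
on the input. All counters are zero at the end, as `Prog.computable` demands. -/
theorem polyRuns_tableProg :
    PolyRuns (tableProg a F k) (fun w => ⟨w, [], fun _ => 0⟩)
      (fun w => ⟨[], encRaw (tableInstance a F k w), fun _ => 0⟩) := by
  open Polynomial in
  have hz : (fun _ => 0 : Counter → ℕ) = counts 0 0 0 0 0 0 0 := by
    funext c
    cases c <;> rfl
  let T := height k
  let J := width k
  let H := heightPoly k
  let N := fun w : List Bool => w.length
  -- The `oᵢ` are successive contents of the output, each extending the previous one on the left.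
  let o₀ : List Bool → List (Token A) := fun _ => closeTokens ++ []
  let o₁ : List Bool → List (Token A) := fun w => encCond (F.triv.map (place 0 0)) ++ o₀ w
  let o₂ : List Bool → List (Token A) := fun w =>
    (w.zipIdx.reverse.flatMap fun x => mk .and :: encCond ((F.init x.1).map (place 0 x.2))) ++ o₁ w
  let o₃ : List Bool → List (Token A) := fun w =>
    blocks (fun j => mk .and :: encCond (F.blank.map (place 0 (N w + j)))) (T w) ++ o₂ w
  let o₄ : List Bool → List (Token A) := fun w =>
    blocks (fun t => blocks (fun j => mk .and :: encCond (F.win.map (place t j))) (J w)) (T w) ++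
      o₃ w
  let o₅ : List Bool → List (Token A) := fun w =>
    mk .and :: encCond (F.acc.map (place (T w) 0)) ++ o₄ w
  let o₆ : List Bool → List (Token A) := fun w => [mk .test, Sum.inr a] ++ o₅ w
  let o₇ : List Bool → List (Token A) := fun w =>
    blocks (fun t => blocks (fun j =>
      (elems S).flatMap fun s => mk .bind :: Sum.inr a :: encName (varName t j s)) (J w + 1))
      (T w + 2) ++ o₆ w
  let o₈ : List Bool → List (Token A) := fun w => openTokens a ++ o₇ w
  have h1 : PolyRuns (writeCond F.triv) (fun w => ⟨w, o₀ w, counts 0 0 0 0 0 0 0⟩)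
      (fun w => ⟨w, o₁ w, counts 0 0 0 0 0 0 0⟩) :=
    .writes (.writeCond F.triv) (fun _ => rfl) 0 0 (by simp [counts]) (by simp [counts])
  have h2 : PolyRuns (.forInput fun b => writeConj (F.init b))
      (fun w => ⟨w, o₁ w, counts 0 0 0 0 0 0 0⟩)
      (fun w => ⟨[], o₂ w, counts 0 (N w) 0 0 0 (N w) 0⟩) := by
    obtain ⟨K, hK⟩ := Runs.forInput fun b => Writes.writeConj (A := A) (F.init b)
    exact .of_eval (fun w => hK w (o₁ w))
      (X * ((K : ℕ[X]) * (X + 1) + 3) + 1)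
      (by simp)
  have h3 : PolyRuns (.power k)
      (fun w => ⟨[], o₂ w, counts 0 (N w) 0 0 0 (N w) 0⟩)
      (fun w => ⟨[], o₂ w, counts 0 (N w) 0 0 0 (N w + k) (T w)⟩) := by
    exact .of_eval (fun w => Runs.power k (N w) (N w) [] (o₂ w))
      ((k : ℕ[X]) + (k : ℕ[X]) * (H * (5 * (X + (k : ℕ[X])) + 5) + 2) + 3)
      (by simp [H, N, height])
  have h4 : PolyRuns (.pad (writeConj F.blank))
      (fun w => ⟨[], o₂ w, counts 0 (N w) 0 0 0 (N w + k) (T w)⟩)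
      (fun w => ⟨[], o₃ w, counts 0 0 0 (T w) (J w) (N w + k) 0⟩) := by
    obtain ⟨K, hK⟩ := Runs.pad (Writes.writeConj (A := A) F.blank)
    exact .of_eval (fun w => hK (N w) (T w) [] (o₂ w) (N w + k))
      (H * ((K : ℕ[X]) * (X + H + 1) + 5) + 2 * X + 2)
      (by simp [H, T, N, height])
  have h5 : PolyRuns (.grid (writeConj F.win))
      (fun w => ⟨[], o₃ w, counts 0 0 0 (T w) (J w) (N w + k) 0⟩)
      (fun w => ⟨[], o₄ w, counts (T w) 0 0 0 (J w) (N w + k) 0⟩) := by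
    obtain ⟨K, hK⟩ := Runs.grid (Writes.writeConj (A := A) F.win)
    exact .of_eval (fun w => hK (T w) (J w) [] (o₃ w) (N w + k) 0)
      (H * ((X + H) * ((K : ℕ[X]) * (H + (X + H) + 1) + 4) + 4) + 1)
      (by simp [H, T, J, height, width])
  have h6 : PolyRuns (writeConj F.acc)
      (fun w => ⟨[], o₄ w, counts (T w) 0 0 0 (J w) (N w + k) 0⟩)
      (fun w => ⟨[], o₅ w, counts (T w) 0 0 0 (J w) (N w + k) 0⟩) :=
    .writes (.writeConj F.acc) (fun _ => rfl) H 0 (by simp [counts, H, T]) (by simp [counts])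
  -- The first grid left `T` in `row`; it is moved back for the second grid.
  have h7 : PolyRuns (.loop .row (.inc .rows))
      (fun w => ⟨[], o₆ w, counts (T w) 0 0 0 (J w) (N w + k) 0⟩)
      (fun w => ⟨[], o₆ w, counts 0 0 0 (T w) (J w) (N w + k) 0⟩) := by
    refine .of_eval (fun w => ?_) (H * 2 + 1) (t := fun w => T w * (1 + 1) + 1) (by simp [H, T])
    have h := Runs.loop (c := .row) (p := .inc .rows) (m := T w) (b := 1)
      (fun t => (⟨[], o₆ w, counts (T w - t) 0 0 t (J w) (N w + k) 0⟩ :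
        Store Bool (Token A) Counter)) (fun j hj => rfl) (by
        intro t ht
        rw [update_row]
        exact .inc (update_rows ..))
    rw [Nat.sub_self, Nat.sub_zero] at h
    exact h
  have h8 : PolyRuns (.grid (writeBinds a (elems S)))
      (fun w => ⟨[], o₆ w, counts 0 0 0 (T w + 2) (J w + 1) (N w + k) 0⟩)
      (fun w => ⟨[], o₇ w, counts (T w + 2) 0 0 0 (J w + 1) (N w + k) 0⟩) := by
    obtain ⟨K, hK⟩ := Runs.grid (Writes.writeBinds (α := Bool) a (elems S))
    exact .of_eval (fun w => hK (T w + 2) (J w + 1) [] (o₆ w) (N w + k) 0)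
      ((H + 2) * ((X + H + 1) * ((K : ℕ[X]) * (H + 2 + (X + H + 1) + 1) + 4) + 4) + 1)
      (by simp [H, T, J, height, width])
  have h9 : PolyRuns (.loop .row .skip)
      (fun w => ⟨[], o₈ w, counts (T w + 2) 0 0 0 (J w + 1) (N w + k) 0⟩)
      (fun w => ⟨[], o₈ w, counts 0 0 0 0 (J w + 1) (N w + k) 0⟩) := by
    exact .of_eval (fun w => Runs.clear (update_row ..))
      (2 * (H + 2) + 1)
      (by simp [H, T, height, counts])
  have h10 : PolyRuns (.loop .cols .skip)
      (fun w => ⟨[], o₈ w, counts 0 0 0 0 (J w + 1) (N w + k) 0⟩)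
      (fun w => ⟨[], o₈ w, counts 0 0 0 0 0 (N w + k) 0⟩) := by
    exact .of_eval (fun w => Runs.clear (update_cols ..))
      (2 * (X + H + 1) + 1)
      (by simp [H, J, height, width, counts])
  have h11 : PolyRuns (.loop .base .skip)
      (fun w => ⟨[], o₈ w, counts 0 0 0 0 0 (N w + k) 0⟩)
      (fun w => ⟨[], o₈ w, counts 0 0 0 0 0 0 0⟩) := by
    exact .of_eval (fun w => Runs.clear (update_base ..))
      (2 * (X + (k : ℕ[X])) + 1)
      (by simp [N, counts])
  have ho : ∀ w, encRaw (tableInstance a F k w) = o₈ w := by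
    intro w
    simp [o₈, o₇, o₆, o₅, o₄, o₃, o₂, o₁, o₀, tableInstance, encRaw_loopInstance, encExpr_bindTest,
      encCond_conj, tableVars, tableConds, blocks, List.flatMap_map, List.flatMap_assoc, T, J, N,
      -List.map_reverse]
  simp only [ho, hz]
  exact (PolyRuns.emits _).seq <| h1.seq <| h2.seq <| h3.seq <| h4.seq <| h5.seq <| h6.seq <|
    (PolyRuns.emits _).seq <| h7.seq <| (PolyRuns.inc fun w => update_rows ..).seq <|
    (PolyRuns.inc fun w => update_rows ..).seq <| (PolyRuns.inc fun w => update_cols ..).seq <|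
    h8.seq <| (PolyRuns.emits _).seq <| h9.seq <| h10.seq h11

end Reduction

/-! ## Satisfiability as a query evaluation problem -/

section Sat

variable {A : Type} (a : A)

theorem fv_bindTest (xs : List Name) (c : Cond Name) :
    (bindTest a xs c).fv = c.vars \ {x | x ∈ xs} := by
  induction xs with
  | nil => simp [bindTest, REWB.fv]
  | cons x xs ih =>
    change (bindTest a xs c).fv \ {x} = _
    rw [ih]
    ext y
    simp [and_assoc, and_comm]

theorem level_bindTest (xs : List Name) (c : Cond Name) : REWB.LevelE 1 (bindTest a xs c) := by
  induction xs with
  | nil => exact .ofF .test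
  | cons x xs ih => exact .bind ih

/-- Whatever values are bound, the word ends with the test, whose valuation and data value are the
witnesses; the graph is irrelevant here. -/
theorem exists_sat_of_mem_lang {xs : List Name} {c : Cond Name} :
    ∀ {ν : Name → Option Name} {w : List (A × Name)}, w ∈ (bindTest a xs c).lang ν →
      ∃ (d : Name) (ν' : Name → Option Name), c.Sat d ν' := by
  induction xs with
  | nil =>
    rintro ν w ⟨d, hd, -⟩
    exact ⟨d, ν, hd⟩
  | cons x xs ih =>
    rintro ν w ⟨d, w', hw, -⟩
    exact ih hw

open Classical in
-- Variables are bound to their truth values, and the test is made at `[true]`. The hypothesis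
-- allows a variable to be in the list or already valued, so that the induction can pass variables
-- from the list to the valuation.
theorem exists_mem_lang {xs : List Name} {c : Cond Name} {b : Name → Prop} (hb : c.Eval b) :
    ∀ {ν : Name → Option Name}, (∀ x ∈ c.vars, x ∈ xs ∨ ν x = some [decide (b x)]) →
      ∃ ds : List Bool, (ds.map fun d => (a, [d])) ∈ (bindTest a xs c).lang ν := by
  induction xs with
  | nil =>
    intro ν hν
    refine ⟨[true], [true], (Cond.sat_iff_eval _ _ _).2 ?_, rfl⟩
    refine (c.eval_congr fun x hx => ?_).1 hb
    rw [(hν x hx).resolve_left List.not_mem_nil]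
    simp
  | cons x xs ih =>
    intro ν hν
    obtain ⟨ds, hds⟩ := ih (ν := Function.update ν x (some [decide (b x)])) (by
      intro y hy
      by_cases hxy : y = x
      · subst hxy
        simp
      · rw [Function.update_of_ne hxy]
        simpa [hxy] using hν y hy)
    refine ⟨decide (b x) :: ds, [decide (b x)], _, hds, rfl⟩

/-- The instance that asks whether a Boolean formula is satisfiable. -/
def satInstance (xs : List Name) (c : Cond Name) (h : ∀ x ∈ c.vars, x ∈ xs) :
    EvalInstance A 1 where
  toRawInstance := loopInstance a (bindTest a xs c)
  src_mem := by
    intro u b d v h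
    simp only [loopInstance, List.mem_cons, Prod.mk.injEq, List.not_mem_nil, or_false] at h ⊢
    exact h.elim And.left And.left
  tgt_mem := by
    intro u b d v h
    simp only [loopInstance, List.mem_cons, Prod.mk.injEq, List.not_mem_nil, or_false] at h ⊢
    exact h.elim (·.2.2.2) (·.2.2.2)
  level := level_bindTest a xs c
  nodup := List.nodup_nil
  dom x := by
    change x ∈ [] ↔ x ∈ (bindTest a xs c).fv
    rw [fv_bindTest]
    simpa using h x
  source_mem := by simp [loopInstance]
  target_mem := by simp [loopInstance]

theorem path_satInstance {xs : List Name} {c : Cond Name} (h : ∀ x ∈ c.vars, x ∈ xs)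
    (ds : List Bool) : (satInstance a xs c h).graph.Path [] (ds.map fun d => (a, [d])) [] := by
  induction ds with
  | nil => exact .nil List.mem_cons_self
  | cons d ds ih =>
    refine .cons (v := []) ?_ ih
    change _ ∈ [([], a, [false], []), ([], a, [true], [])]
    cases d <;> simp

/-- One direction forgets the path. The other needs no care about it, because the two loops spell
every word over the two data values. -/
theorem satInstance_mem_iff {xs : List Name} {c : Cond Name} (h : ∀ x ∈ c.vars, x ∈ xs) :
    satInstance a xs c h ∈ queryEvaluation A 1 ↔ ∃ b, c.Eval b := by
  constructor
  · rintro ⟨w, -, hw⟩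
    obtain ⟨d, ν, hd⟩ := exists_sat_of_mem_lang a hw
    exact ⟨_, (Cond.sat_iff_eval _ _ _).1 hd⟩
  · rintro ⟨b, hb⟩
    obtain ⟨ds, hds⟩ := exists_mem_lang a hb (xs := xs) (ν := (satInstance a xs c h).val)
      fun x hx => .inl (h x hx)
    exact ⟨_, path_satInstance a h ds, hds⟩

end Sat

-- All variables of the formula are bound

section Scope

variable {S : Type} [Finite S]

theorem height_pos (k : ℕ) (w : List Bool) : 0 < height k w := by
  rcases Nat.eq_zero_or_pos k with rfl | hk
  · simp [height]
  · exact Nat.pow_pos (by omega)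

/-- Windows stand at rows up to `T` and columns below `J` and reach one further each way, which
explains the `T + 2` rows and `J + 1` columns of variables. -/
theorem place_mem_tableVars {k t j : ℕ} {w : List Bool} (ht : t ≤ height k w) (hj : j < width k w)
    (v : Slot S) : place t j v ∈ tableVars S k w := by
  obtain ⟨d, c, s⟩ := v
  have hd : t + d.toNat < height k w + 2 := by
    have := Bool.toNat_le d
    omega
  have hc : (c.elim 0 fun b => j + b.toNat) < width k w + 1 := by
    cases c with
    | none => simp
    | some b =>
      have := Bool.toNat_le b
      simp only [Option.elim_some]
      omega
  simp only [tableVars, List.mem_flatMap, List.mem_reverse, List.mem_range, List.mem_map]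
  exact ⟨_, hd, _, hc, s, mem_elems s, rfl⟩

theorem mem_tableConds {k : ℕ} {w : List Bool} {F : TableSpec S} {c : Cond Name} :
    c ∈ tableConds F k w ↔ c = F.acc.map (place (height k w) 0) ∨
      (∃ t < height k w, ∃ j < width k w, F.win.map (place t j) = c) ∨
      (∃ j < height k w, F.blank.map (place 0 (w.length + j)) = c) ∨
      ∃ (j : ℕ) (h : j < w.length), (F.init w[j]).map (place 0 j) = c := by
  simp only [tableConds, List.mem_cons, List.mem_append, List.mem_flatMap, List.mem_map,
    List.mem_reverse, List.mem_range, or_assoc, Prod.exists, List.mem_zipIdx_iff_getElem?,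
    List.getElem?_eq_some_iff]
  refine or_congr_right (or_congr_right (or_congr_right ⟨?_, ?_⟩))
  · rintro ⟨b, j, ⟨h, hb⟩, hc⟩
    exact ⟨j, h, hb ▸ hc⟩
  · rintro ⟨j, h, rfl⟩
    exact ⟨_, j, ⟨h, rfl⟩, rfl⟩

/-- The formula describing the table. -/
noncomputable def tableFormula (F : TableSpec S) (k : ℕ) (w : List Bool) : Cond Name :=
  .conj (tableConds F k w) (F.triv.map (place 0 0))

/-- This makes the expression closed, so the empty valuation is the right one. -/
theorem vars_tableFormula (F : TableSpec S) (k : ℕ) (w : List Bool) :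
    ∀ x ∈ (tableFormula F k w).vars, x ∈ tableVars S k w := by
  have hT := height_pos k w
  have hJ : width k w = w.length + height k w := rfl
  have key : ∀ (c : Cond (Slot S)) (t j : ℕ), t ≤ height k w → j < width k w →
      ∀ x ∈ (c.map (place t j)).vars, x ∈ tableVars S k w := by
    intro c t j ht hj x hx
    rw [Cond.vars_map] at hx
    obtain ⟨v, -, rfl⟩ := hx
    exact place_mem_tableVars ht hj v
  intro x hx
  rcases Cond.mem_vars_conj hx with ⟨c, hc, hx⟩ | hx
  · rcases mem_tableConds.1 hc with rfl | ⟨t, ht, j, hj, rfl⟩ | ⟨j, hj, rfl⟩ | ⟨j, hj, rfl⟩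
    · exact key _ _ _ le_rfl (by omega) x hx
    · exact key _ _ _ ht.le hj x hx
    · exact key _ _ _ hT.le (by omega) x hx
    · exact key _ _ _ hT.le (by omega) x hx
  · exact key _ _ _ hT.le (by omega) x hx

end Scope

/-! ## Computations as tables -/

instance : Finite Turing.Dir :=
  Finite.of_injective (fun d => decide (d = .left)) fun d d' h => by
    cases d <;> cases d' <;> first | rfl | simp at h

theorem ListBlank.cons_default_mk_nil {Γ : Type} [Inhabited Γ] :
    (Turing.ListBlank.mk ([] : List Γ)).cons default = Turing.ListBlank.mk [] :=
  Turing.ListBlank.cons_head_tail (Turing.ListBlank.mk ([] : List Γ))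

namespace NTM

attribute [instance] NTM.finite_Q NTM.finite_Γ

variable {α : Type} (M : NTM α)

/-- An entry of the table: the state in a row (`none` before the first step), the action
taken there (`none` for a pause), the scanned symbol, and the symbols at a certain distance to the
left and to the right of the head. -/
@[ext]
structure Tile where
  state : Option M.Q
  act : Option (M.Γ × Turing.Dir)
  head : M.Γ
  left : M.Γ
  right : M.Γ

instance : Finite M.Tile :=
  Finite.of_injective (fun Y : M.Tile => (Y.state, Y.act, Y.head, Y.left, Y.right))
    fun Y Y' h => by
      simp only [Prod.mk.injEq] at h
      exact Tile.ext h.1 h.2.1 h.2.2.1 h.2.2.2.1 h.2.2.2.2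

instance : Inhabited M.Tile := ⟨⟨none, none, default, default, default⟩⟩

/-- The transitions; the machine begins with a move to the right into its start state. -/
def Allowed : Option M.Q → M.Γ → Option M.Q → M.Γ × Turing.Dir → Prop
  | none, _, q', p => q' = some M.start ∧ p = (default, .right)
  | some q, x, q', p => ∃ r, q' = some r ∧ (r, p) ∈ M.δ q x

/-- The effect of an action on the tape. -/
def actOn : Option (M.Γ × Turing.Dir) → Turing.Tape M.Γ → Turing.Tape M.Γ
  | none, T => T
  | some (b, d), T => (T.write b).move d

/-- A step or a pause. -/
def ActStep (u : Option (M.Γ × Turing.Dir)) (c c' : Option M.Q × Turing.Tape M.Γ) : Prop :=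
  c'.2 = M.actOn u c.2 ∧ u.elim (c'.1 = c.1) fun p => M.Allowed c.1 c.2.head c'.1 p

/-- The tape before the first move. -/
def startTape (w : List α) : Turing.Tape M.Γ :=
  ⟨default, .mk [], .mk (w.map M.letter)⟩

/-- Starting one cell to the left of the input puts its `j`-th letter at distance `j` on the right,
with no exception for the scanned letter. The blank left behind is absorbed by the blank left half.
-/
theorem actOn_startTape (w : List α) :
    M.actOn (some (default, .right)) (M.startTape w) = (M.startCfg w).tape := by
  exact congrArg (fun L => Turing.Tape.mk _ L _) ListBlank.cons_default_mk_nil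

/-- The conditions on the tiles of a window; its first argument says whether the tile is in the
second row, the other one whether it is in the first column of the table (`none`), or in the second
column of the window. -/
def Window (Y : Bool → Option Bool → M.Tile) : Prop :=
  match (Y false none).act with
  | none => (Y true none).state = (Y false none).state ∧ (Y true none).head = (Y false none).head ∧
      (Y true (some false)).left = (Y false (some false)).left ∧
      (Y true (some false)).right = (Y false (some false)).right
  | some (b, .right) =>
      M.Allowed (Y false none).state (Y false none).head (Y true none).state (b, .right) ∧
      (Y true none).head = (Y false none).right ∧ (Y true none).left = b ∧
      (Y true (some true)).left = (Y false (some false)).left ∧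
      (Y true (some false)).right = (Y false (some true)).right
  | some (b, .left) =>
      M.Allowed (Y false none).state (Y false none).head (Y true none).state (b, .left) ∧
      (Y true none).head = (Y false none).left ∧ (Y true none).right = b ∧
      (Y true (some true)).right = (Y false (some false)).right ∧
      (Y true (some false)).left = (Y false (some true)).left

/-- The conditions on the first row. -/
def First (x : M.Γ) (Y : Bool → Option Bool → M.Tile) : Prop :=
  (Y false none).state = none ∧ (Y false none).head = default ∧
    (Y false (some false)).left = default ∧ (Y false (some false)).right = x

/-- The condition on the last row. -/
def Last (Y : Bool → Option Bool → M.Tile) : Prop :=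
  ∃ q ∈ M.accept, (Y false none).state = some q

/-- A part of a table, seen through a window. -/
def look (X : ℕ → ℕ → M.Tile) (t j : ℕ) (d : Bool) (c : Option Bool) : M.Tile :=
  X (t + d.toNat) (c.elim 0 fun b => j + b.toNat)

/-- A table with `T` steps that describes an accepting computation on `w`. -/
structure IsTable (w : List α) (T J : ℕ) (X : ℕ → ℕ → M.Tile) : Prop where
  first : ∀ j < J, M.First ((w.map M.letter).getI j) (M.look X 0 j)
  window : ∀ t < T, ∀ j < J, M.Window (M.look X t j)
  last : M.Last (M.look X T 0)

variable {M}

/-- The entries of row `t` up to column `J - t` describe the state and the tape. -/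
def Matches (X : ℕ → ℕ → M.Tile) (J t : ℕ) (c : Option M.Q × Turing.Tape M.Γ) : Prop :=
  (X t 0).state = c.1 ∧ (X t 0).head = c.2.head ∧
    ∀ j, j + t < J → (X t j).left = c.2.left.nth j ∧ (X t j).right = c.2.right.nth j

/-- Away from column `0`, a new entry depends on the previous row within distance one. The entry in
column `j` may need column `j + 1`, so the reliable part shrinks by one column. -/
theorem Matches.step {X : ℕ → ℕ → M.Tile} {J t : ℕ} {c : Option M.Q × Turing.Tape M.Γ}
    (h : Matches X J t c) (ht : t < J) (hX : ∀ j < J, M.Window (M.look X t j)) :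
    ∃ c', Matches X J (t + 1) c' ∧ M.ActStep (X t 0).act c c' := by
  obtain ⟨q, a, L, R⟩ := c
  obtain ⟨h1, h2, h3⟩ := h
  simp only at h1 h2 h3
  have h0 := h3 0 (by omega)
  simp only [Window, look, Option.elim_none, Option.elim_some, Bool.toNat_false, Bool.toNat_true,
    Nat.add_zero, h1, h2] at hX
  cases hu : (X t 0).act with
  | none =>
    simp only [hu] at hX
    refine ⟨(q, ⟨a, L, R⟩), ⟨(hX 0 (by omega)).1, (hX 0 (by omega)).2.1, fun j hj => ?_⟩, rfl, rfl⟩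
    rw [(hX j (by omega)).2.2.1, (hX j (by omega)).2.2.2]
    exact h3 j (by omega)
  | some p =>
    obtain ⟨b, d⟩ := p
    simp only [hu] at hX
    cases d with
    | right =>
      refine ⟨((X (t + 1) 0).state, M.actOn (some (b, .right)) ⟨a, L, R⟩), ⟨rfl, ?_, fun j hj => ?_⟩,
        rfl, (hX 0 (by omega)).1⟩
      · rw [(hX 0 (by omega)).2.1, h0.2, Turing.ListBlank.nth_zero]
        rfl
      · refine ⟨?_, ?_⟩
        · change _ = (L.cons b).nth j
          cases j with
          | zero => simpa using (hX 0 (by omega)).2.2.1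
          | succ j =>
            rw [(hX j (by omega)).2.2.2.1, Turing.ListBlank.nth_succ, Turing.ListBlank.tail_cons]
            exact (h3 j (by omega)).1
        · change _ = R.tail.nth j
          rw [(hX j (by omega)).2.2.2.2, ← Turing.ListBlank.nth_succ]
          exact (h3 (j + 1) (by omega)).2
    | left =>
      refine ⟨((X (t + 1) 0).state, M.actOn (some (b, .left)) ⟨a, L, R⟩), ⟨rfl, ?_, fun j hj => ?_⟩,
        rfl, (hX 0 (by omega)).1⟩
      · rw [(hX 0 (by omega)).2.1, h0.1, Turing.ListBlank.nth_zero]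
        rfl
      · refine ⟨?_, ?_⟩
        · change _ = L.tail.nth j
          rw [(hX j (by omega)).2.2.2.2, ← Turing.ListBlank.nth_succ]
          exact (h3 (j + 1) (by omega)).1
        · change _ = (R.cons b).nth j
          cases j with
          | zero => simpa using (hX 0 (by omega)).2.2.1
          | succ j =>
            rw [(hX j (by omega)).2.2.2.1, Turing.ListBlank.nth_succ, Turing.ListBlank.tail_cons]
            exact (h3 j (by omega)).2

/-- Some computation on `w` leads to the configuration `c`. -/
def Reached (M : NTM α) (w : List α) (c : M.Cfg) : Prop :=
  Relation.ReflTransGen M.Step (M.startCfg w) c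

theorem Reached.acceptsIn {w : List α} {c : M.Cfg} (h : M.Reached w c) (hc : c.state ∈ M.accept) :
    ∃ t, M.AcceptsIn w t := by
  have key : ∃ (t : ℕ) (f : ℕ → M.Cfg), f 0 = M.startCfg w ∧
      (∀ j < t, M.Step (f j) (f (j + 1))) ∧ f t = c := by
    clear hc
    induction h with
    | refl => exact ⟨0, fun _ => M.startCfg w, rfl, by simp, rfl⟩
    | @tail c c' _ hs ih =>
      obtain ⟨t, f, h0, hf, rfl⟩ := ih
      refine ⟨t + 1, fun j => if j ≤ t then f j else c', by simpa using h0, fun j hj => ?_, by simp⟩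
      rcases Nat.lt_succ_iff_lt_or_eq.1 hj with hj | rfl
      · simpa [hj.le, Nat.succ_le_of_lt hj] using hf j hj
      · simpa using hs
  obtain ⟨t, f, h0, hf, rfl⟩ := key
  exact ⟨t, f, h0, hf, hc⟩

/-- By induction, each row describes the tape before the first move or a reachable configuration;
the last row has a state, which rules out the former. By `T ≤ J`, column `0` is still reliable
whenever a step is taken. -/
theorem IsTable.acceptsIn {w : List α} {T J : ℕ} (hT : 0 < T) (hJ : T ≤ J) {X : ℕ → ℕ → M.Tile}
    (hX : M.IsTable w T J X) : ∃ t, M.AcceptsIn w t := by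
  have key : ∀ t ≤ T, ∃ c, Matches X J t c ∧
      (c = (none, M.startTape w) ∨ ∃ q, c.1 = some q ∧ M.Reached w ⟨q, c.2⟩) := by
    intro t
    induction t with
    | zero =>
      refine fun _ => ⟨(none, M.startTape w), ⟨?_, ?_, fun j hj => ⟨?_, ?_⟩⟩, .inl rfl⟩
      · exact (hX.first 0 (by omega)).1
      · exact (hX.first 0 (by omega)).2.1
      · refine (hX.first j (by omega)).2.2.1.trans ?_
        simp [startTape]
      · refine (hX.first j (by omega)).2.2.2.trans ?_
        simp [startTape]
    | succ t ih =>
      intro ht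
      obtain ⟨c, hc, hr⟩ := ih (by omega)
      obtain ⟨⟨q', T'⟩, hc', h1, h2⟩ := hc.step (by omega) (hX.window t (by omega))
      refine ⟨_, hc', ?_⟩
      cases hu : (X t 0).act with
      | none =>
        rw [hu] at h1 h2
        have e : (q', T') = c := Prod.ext h2 h1
        rwa [e]
      | some p =>
        rw [hu] at h1 h2
        rcases hr with rfl | ⟨q, hq, hr⟩
        · obtain ⟨rfl, rfl⟩ := h2
          refine .inr ⟨M.start, rfl, ?_⟩
          rw [show T' = _ from h1, actOn_startTape]
          exact .refl
        · simp only [hq, Option.elim_some, Allowed] at h2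
          obtain ⟨r, rfl, h2⟩ := h2
          exact .inr ⟨r, rfl, hr.tail ⟨r, p.1, p.2, h2, congrArg (Cfg.mk r) h1⟩⟩
  obtain ⟨c, ⟨hc, -⟩, hr⟩ := key T le_rfl
  obtain ⟨q, hq, hq'⟩ := hX.last
  replace hq' : some q = c.1 := hq'.symm.trans hc
  rcases hr with rfl | ⟨q₁, h1, hr⟩
  · exact absurd hq' (by simp)
  · rw [h1] at hq'
    exact hr.acceptsIn (Option.some.inj hq' ▸ hq)

theorem exists_isTable {w : List α} {t T J : ℕ} (ht : t < T) (h : M.AcceptsIn w t) :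
    ∃ X, M.IsTable w T J X := by
  obtain ⟨f, h0, hf, hacc⟩ := h
  -- The initial move occupies one row, hence `t < T`; after `t` steps the computation is frozen by
  -- pauses.
  let C : ℕ → Option M.Q × Turing.Tape M.Γ := fun
    | 0 => (none, M.startTape w)
    | i + 1 => (some (f (min i t)).state, (f (min i t)).tape)
  have hC : ∀ i, ∃ u, M.ActStep u (C i) (C (i + 1)) := by
    rintro (_ | i)
    · refine ⟨some (default, .right), ?_, ?_, rfl⟩
      · simp only [C, actOn_startTape, Nat.zero_min, h0]
      · simp only [C, Nat.zero_min, h0]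
        rfl
    · rcases lt_or_ge i t with hi | hi
      · obtain ⟨q, b, d, hδ, hs⟩ := hf i hi
        refine ⟨some (b, d), ?_, q, ?_, ?_⟩
        · simp only [C, min_eq_left hi.le, min_eq_left (Nat.succ_le_of_lt hi), hs]
          rfl
        · simp only [C, min_eq_left (Nat.succ_le_of_lt hi), hs]
        · simpa only [C, min_eq_left hi.le] using hδ
      · refine ⟨none, ?_, ?_⟩
        · simp only [C, min_eq_right hi, min_eq_right (hi.trans (Nat.le_succ i))]
          rfl
        · simp only [C, min_eq_right hi, min_eq_right (hi.trans (Nat.le_succ i))]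
          trivial
  choose u hu using hC
  refine ⟨fun i j => ⟨(C i).1, u i, (C i).2.head, (C i).2.left.nth j, (C i).2.right.nth j⟩,
    fun j hj => ⟨rfl, rfl, ?_, ?_⟩, fun i hi j hj => ?_, ⟨_, hacc, ?_⟩⟩
  · simp [look, C, startTape]
  · simp [look, C, startTape]
  · obtain ⟨h1, h2⟩ := hu i
    simp only [Window, look, Option.elim_none, Option.elim_some, Bool.toNat_false,
      Bool.toNat_true, Nat.add_zero]
    generalize C i = c at *
    generalize C (i + 1) = c' at *
    obtain ⟨q, a, L, R⟩ := c
    cases hui : u i with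
    | none =>
      rw [hui] at h1 h2
      rw [show c' = _ from Prod.ext h2 h1]
      exact ⟨rfl, rfl, rfl, rfl⟩
    | some p =>
      obtain ⟨b, d⟩ := p
      rw [hui] at h1 h2
      cases d <;> refine ⟨h2, ?_⟩ <;> rw [h1] <;>
        simp [actOn, Turing.Tape.move, Turing.Tape.write]
  · obtain ⟨i, rfl⟩ : ∃ i, T = i + 1 := ⟨T - 1, by omega⟩
    simp [look, C, min_eq_right (show t ≤ i by omega)]

end NTM

/-! ## The reduction -/

/-- From a bound `c * (n + 1) ^ d`, the choice `k = c + d + 1` lets one extra factor `n + k` absorb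
`c + 1`. The `+ 1` on the left leaves room for the initial move. -/
theorem exists_le_pow (p : Polynomial ℕ) : ∃ k : ℕ, ∀ n, p.eval n + 1 ≤ (n + k) ^ k := by
  obtain ⟨c, d, h⟩ : ∃ c d : ℕ, ∀ n, p.eval n ≤ c * (n + 1) ^ d := by
    induction p using Polynomial.induction_on' with
    | add p q hp hq =>
      obtain ⟨c, d, h⟩ := hp
      obtain ⟨c', d', h'⟩ := hq
      refine ⟨c + c', d + d', fun n => ?_⟩
      rw [Polynomial.eval_add, Nat.add_mul]
      exact Nat.add_le_add
        ((h n).trans (Nat.mul_le_mul_left _ (Nat.pow_le_pow_right (by omega) (by omega))))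
        ((h' n).trans (Nat.mul_le_mul_left _ (Nat.pow_le_pow_right (by omega) (by omega))))
    | monomial d c =>
      refine ⟨c, d, fun n => ?_⟩
      rw [Polynomial.eval_monomial]
      exact Nat.mul_le_mul_left _ (Nat.pow_le_pow_left (by omega) _)
  refine ⟨c + d + 1, fun n => ?_⟩
  have h1 : 1 ≤ (n + 1) ^ d := Nat.one_le_pow _ _ (by omega)
  calc p.eval n + 1 ≤ c * (n + 1) ^ d + (n + 1) ^ d := Nat.add_le_add (h n) h1
    _ = (n + 1) ^ d * (c + 1) := by ring
    _ ≤ (n + (c + d + 1)) ^ d * (n + (c + d + 1)) :=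
      Nat.mul_le_mul (Nat.pow_le_pow_left (by omega) _) (by omega)
    _ = (n + (c + d + 1)) ^ (d + 1) := (pow_succ _ _).symm
    _ ≤ (n + (c + d + 1)) ^ (c + d + 1) := Nat.pow_le_pow_right (by omega) (by omega)

-- Assignments as tables

section Decode

variable {S : Type} [Inhabited S]

open Classical in
/-- The element of `S` encoded by a set: one of the elements of the set. -/
noncomputable def pick (b : S → Prop) : S := if h : ∃ s, b s then h.choose else default

theorem pick_eq (s : S) : pick (fun s' => s = s') = s := by
  have h : ∃ s', s = s' := ⟨s, rfl⟩
  rw [pick, dif_pos h]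
  exact h.choose_spec.symm

variable [Finite S]

/-- A condition that expresses a property of a window. -/
noncomputable def windowCond (P : (Bool → Option Bool → S) → Prop) : Cond (Slot S) :=
  (Cond.definable fun b : Slot S → Prop => P fun d c => pick fun s => b (d, c, s)).choose

/-- The table described by an assignment. -/
noncomputable def tableOf (b : Name → Prop) (t j : ℕ) : S := pick fun s => b (varName t j s)

/-- Decoding a window depends on its finitely many variables only, so any property of windows yields
a condition, which is then transported to its place by renaming. -/
theorem eval_windowCond (P : (Bool → Option Bool → S) → Prop) (t j : ℕ) (b : Name → Prop) :
    ((windowCond P).map (place t j)).Eval b ↔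
      P fun d c => tableOf b (t + d.toNat) (c.elim 0 fun b => j + b.toNat) :=
  (Cond.eval_map _ _ _).trans ((Cond.definable _).choose_spec _)

/-- Exactly the variables naming the entries of `X` are made true. As names are unambiguous, each
cell gets a singleton, where `pick` has no choice. -/
theorem exists_tableOf_eq (X : ℕ → ℕ → S) : ∃ b, tableOf b = X := by
  refine ⟨fun x => ∃ t j, x = varName t j (X t j), ?_⟩
  funext t j
  refine Eq.trans (congrArg pick (funext fun s => propext ⟨?_, ?_⟩)) (pick_eq (X t j))
  · rintro ⟨t', j', h⟩
    obtain ⟨rfl, rfl, rfl⟩ := varName_inj h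
    rfl
  · rintro rfl
    exact ⟨t, j, rfl⟩

end Decode

-- The formula expresses that there is an accepting table

namespace NTM

variable (M : NTM Bool)

/-- The conditions for a table that describes an accepting computation. -/
noncomputable def tableSpec : TableSpec M.Tile where
  init b := windowCond (M.First (M.letter b))
  blank := windowCond (M.First default)
  win := windowCond M.Window
  acc := windowCond M.Last
  triv := windowCond fun _ => True

/-- The first row is prescribed letter by letter on the input and by `blank` on the remaining
columns; `getI` unifies the two, since its default value is the blank. -/
theorem eval_tableFormula (k : ℕ) (w : List Bool) (b : Name → Prop) :
    (tableFormula M.tableSpec k w).Eval b ↔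
      M.IsTable w (height k w) (width k w) (tableOf b) := by
  rw [tableFormula, Cond.eval_conj]
  constructor
  · rintro ⟨h, -⟩
    simp only [mem_tableConds] at h
    refine ⟨fun j hj => ?_, fun t ht j hj => ?_, ?_⟩
    · rcases lt_or_ge j w.length with hw | hw
      · have h1 := (eval_windowCond _ _ _ _).1 (h _ (.inr (.inr (.inr ⟨j, hw, rfl⟩))))
        rw [List.getI_eq_getElem _ (by simpa using hw), List.getElem_map]
        exact h1
      · obtain ⟨i, rfl⟩ := Nat.exists_eq_add_of_le hw
        have h1 := (eval_windowCond _ _ _ _).1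
          (h _ (.inr (.inr (.inl ⟨i, Nat.lt_of_add_lt_add_left hj, rfl⟩))))
        rw [List.getI_eq_default _ (by simp)]
        exact h1
    · exact (eval_windowCond _ _ _ _).1 (h _ (.inr (.inl ⟨t, ht, j, hj, rfl⟩)))
    · exact (eval_windowCond _ _ _ _).1 (h _ (.inl rfl))
  · rintro ⟨h1, h2, h3⟩
    refine ⟨fun c hc => ?_, (eval_windowCond (fun _ => True) 0 0 b).2 trivial⟩
    have hJ : width k w = w.length + height k w := rfl
    rcases mem_tableConds.1 hc with rfl | ⟨t, ht, j, hj, rfl⟩ | ⟨j, hj, rfl⟩ | ⟨j, hj, rfl⟩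
    · exact (eval_windowCond _ _ _ _).2 h3
    · exact (eval_windowCond _ _ _ _).2 (h2 t ht j hj)
    · have h4 := h1 (w.length + j) (by omega)
      rw [List.getI_eq_default _ (by simp)] at h4
      exact (eval_windowCond _ _ _ _).2 h4
    · have h4 := h1 j (by omega)
      rw [List.getI_eq_getElem _ (by simpa using hj), List.getElem_map] at h4
      exact (eval_windowCond _ _ _ _).2 h4

end NTM

end RegBind

/-- For queries in `E_1`, the evaluation problem is NP-hard. -/
theorem mainTheorem4 (A : Type) [Fintype A] [Nonempty A] :
    RegBind.NPHard (RegBind.instanceEncoding A 1) (RegBind.queryEvaluation A 1) := by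
  open RegBind in
  rintro L ⟨M, p, hL⟩
  obtain ⟨a⟩ := ‹Nonempty A›
  obtain ⟨k, hk⟩ := exists_le_pow p
  refine ⟨fun w => satInstance a (tableVars M.Tile k w) (tableFormula M.tableSpec k w)
    (vars_tableFormula _ k w), ?_, fun w => ?_⟩
  · obtain ⟨P, hP⟩ := polyRuns_tableProg a M.tableSpec k
    exact Prog.computable (tableProg a M.tableSpec k) _ _ P hP
  · simp only [satInstance_mem_iff, NTM.eval_tableFormula]
    constructor
    · intro hw
      obtain ⟨t, ht, h⟩ := (hL w).1 hw
      have hT : t < height k w := lt_of_lt_of_le (Nat.lt_succ_of_le ht) (hk w.length)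
      obtain ⟨X, hX⟩ := NTM.exists_isTable (J := width k w) hT h
      obtain ⟨b, rfl⟩ := exists_tableOf_eq X
      exact ⟨b, hX⟩
    · rintro ⟨b, hb⟩
      exact (hL w).2 (hb.acceptsIn (height_pos k w) (Nat.le_add_left _ _))
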